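/- **Theorem 3.2 (Weak Harnack inequality).** Let $n\ge 1$, $s\in(0,1)$ and $\lambda>1$, $\Lambda<\infty$. There are constants $\sigma\in(0,1)$ and $c_0>0$, depending only on $n,s,\lambda,\Lambda$, with the following property. Let $g:\mathbb R\to\mathbb R$ be odd, with $g(0)=0$, $g>0$ on $(0,\infty)$, $g$ nondecreasing on $(0,\infty)$, right continuous and locally absolutely continuous on $[0,\infty)$, $g(t)\to\infty$ as $t\to\infty$, $g$ convex on $(0,\infty)$, and $\lambda\le \frac{t g'(t)}{g(t)}\le\Lambda$ for a.e. $t>0$; let $g^{-1}:[0,\infty)\to[0,\infty)$ be the inverse of $g|_{[0,\infty)}$. Put $G(t)=\int_0^{|t|}g$, $D_su(x,y)=\frac{u(x)-u(y)}{|x-y|^s}$ and $d\mu=\frac{dx\,dy}{|x-y|^n}$ on $\mathbb R^n\times\mathbb R^n$. Let $B_r$ denote the ball of radius $r$ centred at $0$, and let $R>0$, $K\ge 0$. For open $U\subset\mathbb R^n$, $W^{s,G}(U)$ is the space of measurable $u$ on $U$ with $\int_U G(u)\,dx<\infty$ and $\iint_{U\times U}G(D_su)\,d\mu<\infty$; for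 bounded open $\Omega$, $W^{s,G}_0(\Omega)$ is the space of $\varphi\in W^{s,G}(\mathbb R^n)$ with $\varphi=0$ a.e. outside $\Omega$, and $\widetilde W^{s,G}(\Omega)$ is the space of measurable $u:\mathbb R^n\to\mathbb R$ with $\int_Q G(u)\,dx<\infty$ for every compact $Q\subset\mathbb R^n$, $u\in W^{s,G}(U)$ for some open $U\supset\overline\Omega$, and $\int_{\mathbb R^n} g\left(\frac{|u(x)|}{(1+|x|)^s}\right)\frac{dx}{(1+|x|)^{n+s}}<\infty$. Let $u\in\widetilde W^{s,G}(B_{R/3})$ satisfy $u\ge0$ a.e. in $\mathbb R^n$ and $(-\Delta_g)^su\ge -K$ weakly in $B_{R/3}$, that is, $$\iint_{\mathbb R^n\times\mathbb R^n} g(D_su)\,D_s\varphi\,d\mu\ \ge\ -K\int_{B_{R/3}}\varphi\,dx\qquad\text{for all }\varphi\in W^{s,G}_0(B_{R/3})\text{ with }\varphi\ge0\text{ a.e. in }B_{R/3}.$$ Then, with $C_0=c_0R^s$, $$\operatorname*{ess\,inf}_{B_{R/4}}u\ \ge\ \sigma R^s g^{-1}\left(\frac{1}{|B_R\setminus B_{R/2}|}\int_{B_R\setminus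 B_{R/2}} g(R^{-s}|u|)\,dx\right)-R^sg^{-1}(C_0K).$$ -/

import Mathlib

open MeasureTheory Set Filter Topology

noncomputable section

namespace FracOrlicz

/-- The space `ℝⁿ` with its Euclidean norm. -/
abbrev E (n : ℕ) : Type := EuclideanSpace ℝ (Fin n)

/-- The admissible densities `g = G'` of Young functions. Here `g` is already extended to all of
`ℝ` as an odd function; it satisfies `(g₁)`, `(g₂)`, `(g₃)`, is right continuous and (locally)
absolutely continuous on `[0, ∞)`, is convex on `(0, ∞)`, and satisfies
`lam ≤ t g'(t) / g(t) ≤ Lam` for almost every `t > 0`. -/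
structure IsAdmissible (lam Lam : ℝ) (g : ℝ → ℝ) : Prop where
  odd : ∀ t, g (-t) = -g t
  zero : g 0 = 0
  pos : ∀ t, 0 < t → 0 < g t
  mono : MonotoneOn g (Ioi 0)
  rightCont : ∀ t, 0 ≤ t → ContinuousWithinAt g (Ici t) t
  tendsto : Tendsto g atTop atTop
  absCont : ∀ T, 0 < T → AbsolutelyContinuousOnInterval g 0 T
  elliptic : ∀ᵐ t ∂(volume.restrict (Ioi (0 : ℝ))),
    lam ≤ t * deriv g t / g t ∧ t * deriv g t / g t ≤ Lam
  convex : ConvexOn ℝ (Ioi 0) g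

/-- The inverse `g⁻¹ : [0, ∞) → [0, ∞)` of the restriction of `g` to `[0, ∞)`
(for admissible `g` this restriction is a bijection of `[0, ∞)`). -/
def ginv (g : ℝ → ℝ) : ℝ → ℝ := Function.invFunOn g (Ici 0)

/-- The Young function `G(t) = ∫₀ᵗ g`, extended to `ℝ` as an even function. -/
def young (g : ℝ → ℝ) (t : ℝ) : ℝ := ∫ τ in (0 : ℝ)..|t|, g τ

/-- Membership in the Orlicz space `L^G(ν)`: `u` is measurable and `∫ G(u) dν < ∞`. -/
def MemLG {α : Type*} [MeasurableSpace α] (g : ℝ → ℝ) (ν : Measure α) (u : α → ℝ) : Prop :=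
  AEStronglyMeasurable u ν ∧ ∫⁻ x, ENNReal.ofReal (young g (u x)) ∂ν < ⊤

/-- The measure `dμ = dx dy / |x - y|ⁿ` on `ℝⁿ × ℝⁿ`. -/
def mu (n : ℕ) : Measure (E n × E n) :=
  (volume : Measure (E n × E n)).withDensity
    fun p => ENNReal.ofReal (1 / ‖p.1 - p.2‖ ^ n)

/-- The `s`-Hölder quotient `D_s u(x, y) = (u(x) - u(y)) / |x - y|^s`. -/
def holderQuot {n : ℕ} (s : ℝ) (u : E n → ℝ) (p : E n × E n) : ℝ :=
  (u p.1 - u p.2) / ‖p.1 - p.2‖ ^ s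

/-- Membership in the fractional Orlicz-Sobolev space `W^{s,G}(Ω)`. -/
def MemW {n : ℕ} (g : ℝ → ℝ) (s : ℝ) (Ω : Set (E n)) (u : E n → ℝ) : Prop :=
  MemLG g (volume.restrict Ω) u ∧ MemLG g ((mu n).restrict (Ω ×ˢ Ω)) (holderQuot s u)

/-- Membership in `W₀^{s,G}(Ω)`: functions in `W^{s,G}(ℝⁿ)` that vanish a.e. outside `Ω`. -/
def MemW₀ {n : ℕ} (g : ℝ → ℝ) (s : ℝ) (Ω : Set (E n)) (u : E n → ℝ) : Prop :=
  MemW g s univ u ∧ ∀ᵐ x ∂(volume : Measure (E n)), x ∉ Ω → u x = 0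

/-- Membership in `L^G_loc(ℝⁿ)`. -/
def MemLGloc {n : ℕ} (g : ℝ → ℝ) (u : E n → ℝ) : Prop :=
  ∀ Q : Set (E n), IsCompact Q → MemLG g (volume.restrict Q) u

/-- Membership in `W̃^{s,G}(Ω)`, for bounded `Ω`: `u ∈ L^G_loc(ℝⁿ)`, `u` lies in `W^{s,G}(U)` for
some open `U ⊃⊃ Ω` (that is, its `W^{s,G}(U)` norm is finite), and
`∫ g(|u(x)| / (1 + |x|)^s) / (1 + |x|)^(n + s) dx < ∞`. -/
def MemWTilde {n : ℕ} (g : ℝ → ℝ) (s : ℝ) (Ω : Set (E n)) (u : E n → ℝ) : Prop :=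
  MemLGloc g u ∧
  (∃ U : Set (E n), IsOpen U ∧ IsCompact (closure Ω) ∧ closure Ω ⊆ U ∧ MemW g s U u) ∧
  ∫⁻ x : E n, ENNReal.ofReal
    (g (|u x| / (1 + ‖x‖) ^ s) / (1 + ‖x‖) ^ ((n : ℝ) + s)) < ⊤

/-- `u ∈ W̃^{s,G}(Ω)` is a weak subsolution of `(-Δ_g)^s u = f` in the bounded set `Ω`. -/
def IsWeakSubsolution {n : ℕ} (g : ℝ → ℝ) (s : ℝ) (Ω : Set (E n)) (f u : E n → ℝ) : Prop :=
  MemWTilde g s Ω u ∧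
  ∀ φ : E n → ℝ, MemW₀ g s Ω φ → (∀ᵐ x ∂(volume.restrict Ω), 0 ≤ φ x) →
    ∫ p, g (holderQuot s u p) * holderQuot s φ p ∂(mu n) ≤ ∫ x in Ω, f x * φ x

/-- `u` is a weak supersolution of `(-Δ_g)^s u = f` in `Ω`, i.e. `(-Δ_g)^s u ≥ f` weakly in `Ω`:
`-u` is a weak subsolution of `(-Δ_g)^s v = -f` (recall that `g` is odd). -/
def IsWeakSupersolution {n : ℕ} (g : ℝ → ℝ) (s : ℝ) (Ω : Set (E n)) (f u : E n → ℝ) : Prop :=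
  IsWeakSubsolution g s Ω (fun x => -f x) (fun x => -u x)

end FracOrlicz

end

/-!
The proof tests the equation with `φ = (v - u)₊`, where `v` is a multiple `h η` of the explicit
profile `η(x) = (144/7) (1/9 - |x|²/R²)₊`, which is at least `1` on `B_{R/4}` and vanishes outside
`B_{R/3}`. Three facts are combined.

* The barrier satisfies `(-Δ_g)^s v ≤ C R^(-s) g(h R^(-s))` weakly (`integral_barrierKernel_le`). As
  `η` is a maximum of two smooth functions, its second differences are bounded on the side that is
  needed, and by convexity and doubling `g` has slope at most `2 g(2m)/m` on `[-m, m]`. Together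
  they make the symmetrized kernel integrable (`barrierKernel_symm_le`); the passage from the
  kernel to the form is `integral_antisymm_le`.
* The integrand `(g(D_s v) - g(D_s u)) D_s φ` is nonnegative everywhere, since `g` is monotone and
  `φ` is a nondecreasing function of `v - u`.
* For `x` in `B_{R/3}` with `φ(x) > 0` and `y` in the annulus `B_R \ B_{R/2}`, where `v` and `φ`
  vanish, this integrand is at least a multiple of `φ(x) g(R^(-s) u(y))` (`annulus_gain`): for a
  convex odd `g` one has `g(a) - g(b) ≥ g((a - b)/2)` if `a ≥ b`.

Hence, if `φ` is not null, the average `M` of `g(R^(-s) u)` over the annulus satisfies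
`c M ≤ C g(h R^(-s)) + R^s K` (`integral_annulus_le`). For `h = R^s (σ g⁻¹(M) - g⁻¹(R^s K)) > 0`
both terms on the right are at most multiples of `g(σ g⁻¹(M)) ≤ σ M`, which is impossible for small
`σ`; so `φ = 0`, that is `u ≥ h` on `B_{R/4}`. If `h ≤ 0`, the claim follows from `u ≥ 0`.

The manipulation of the forms requires that they converge. For `v` this is a direct estimate, and
for `u` it uses the modular of `u` near the ball and the tail condition far from it
(`integrable_form`). Of the hypotheses on `g` only convexity and the doubling property
`g(2t) ≤ D g(t)`, with `D` determined by the upper growth exponent, enter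
(`IsAdmissible.isDoublingDensity`).
-/

noncomputable section
namespace FracOrlicz

/-! ### Growth of admissible densities -/

/-- The properties of an admissible density that the argument uses: an odd increasing convex
function whose growth is controlled by the single doubling constant `D`. -/
structure IsDoublingDensity (D : ℝ) (g : ℝ → ℝ) : Prop where
  odd : ∀ t, g (-t) = -g t
  pos : ∀ t, 0 < t → 0 < g t
  mono : Monotone g
  cont : Continuous g
  convex : ConvexOn ℝ (Ici 0) g
  doubling : ∀ t, 0 ≤ t → g (2 * t) ≤ D * g t
  tendsto : Tendsto g atTop atTop

/-- An upper bound for `g (c * t) / g t`, uniform over all densities with doubling constant `D`: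
since `c ≤ 2 ^ ⌈c⌉₊`, at most `⌈c⌉₊` doublings are needed. The maximum with `1` makes the constant
at least `1` for every `D`. -/
def growthConst (D c : ℝ) : ℝ := max D 1 ^ ⌈c⌉₊

lemma one_le_growthConst (D c : ℝ) : 1 ≤ growthConst D c := one_le_pow₀ (le_max_right _ _)

lemma growthConst_pos (D c : ℝ) : 0 < growthConst D c :=
  zero_lt_one.trans_le (one_le_growthConst D c)

namespace IsDoublingDensity

variable {D : ℝ} {g : ℝ → ℝ}

lemma zero (hg : IsDoublingDensity D g) : g 0 = 0 := by
  have := hg.odd 0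
  simp only [neg_zero] at this
  linarith

lemma nonneg (hg : IsDoublingDensity D g) {t : ℝ} (ht : 0 ≤ t) : 0 ≤ g t := by
  rw [← hg.zero]; exact hg.mono ht

lemma const_nonneg (hg : IsDoublingDensity D g) : 0 ≤ D := by
  by_contra! h
  have h1 := hg.doubling 1 zero_le_one
  have h2 := hg.pos 1 one_pos
  have h3 := hg.pos (2 * 1) (by norm_num)
  nlinarith

lemma abs_apply (hg : IsDoublingDensity D g) (t : ℝ) : |g t| = g |t| := by
  rcases le_total 0 t with h | h
  · rw [abs_of_nonneg h, abs_of_nonneg (hg.nonneg h)]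
  · rw [abs_of_nonpos h, hg.odd, abs_of_nonpos]
    rw [← hg.zero]; exact hg.mono h

lemma apply_mul_le (hg : IsDoublingDensity D g) {c t : ℝ} (hc : 0 ≤ c) (hc1 : c ≤ 1)
    (ht : 0 ≤ t) : g (c * t) ≤ c * g t := by
  have := hg.convex.2 (x := t) (y := 0) (mem_Ici.2 ht) (mem_Ici.2 le_rfl) hc
    (sub_nonneg.2 hc1) (by ring)
  simpa [hg.zero] using this

lemma superadd (hg : IsDoublingDensity D g) {a b : ℝ} (ha : 0 ≤ a) (hb : 0 ≤ b) :
    g a + g b ≤ g (a + b) := by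
  rcases eq_or_lt_of_le (add_nonneg ha hb) with h | h
  · have h1 : a = 0 := by linarith
    have h2 : b = 0 := by linarith
    simp [h1, h2, hg.zero]
  · have e1 := hg.apply_mul_le (c := a / (a + b)) (t := a + b) (by positivity)
      ((div_le_one h).2 (by linarith)) h.le
    have e2 := hg.apply_mul_le (c := b / (a + b)) (t := a + b) (by positivity)
      ((div_le_one h).2 (by linarith)) h.le
    rw [div_mul_cancel₀ _ h.ne'] at e1 e2
    have : a / (a + b) * g (a + b) + b / (a + b) * g (a + b) = g (a + b) := by
      field_simp
    linarith

lemma apply_mul_le_growthConst (hg : IsDoublingDensity D g) (c : ℝ) {t : ℝ} (ht : 0 ≤ t) :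
    g (c * t) ≤ growthConst D c * g t := by
  have key : ∀ m : ℕ, g (2 ^ m * t) ≤ max D 1 ^ m * g t := by
    intro m
    induction m with
    | zero => simp
    | succ k ih =>
      have h0 : 0 ≤ 2 ^ k * t := by positivity
      calc g (2 ^ (k + 1) * t) = g (2 * (2 ^ k * t)) := by ring_nf
        _ ≤ D * g (2 ^ k * t) := hg.doubling _ h0
        _ ≤ max D 1 * g (2 ^ k * t) :=
          mul_le_mul_of_nonneg_right (le_max_left _ _) (hg.nonneg h0)
        _ ≤ max D 1 * (max D 1 ^ k * g t) :=
          mul_le_mul_of_nonneg_left ih (zero_le_one.trans (le_max_right _ _))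
        _ = max D 1 ^ (k + 1) * g t := by ring
  refine le_trans (hg.mono ?_) (key ⌈c⌉₊)
  refine mul_le_mul_of_nonneg_right ((Nat.le_ceil c).trans ?_) ht
  exact_mod_cast (Nat.lt_two_pow_self).le

/-- A quantitative strict monotonicity: increments of `g` are at least the value of `g` at half
the increment of the argument. -/
lemma apply_half_sub_le (hg : IsDoublingDensity D g) {a b : ℝ} (hab : b ≤ a) :
    g ((a - b) / 2) ≤ g a - g b := by
  rcases le_total 0 b with hb | hb
  · have := hg.superadd hb (sub_nonneg.2 hab)
    rw [add_sub_cancel] at this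
    have h2 : g ((a - b) / 2) ≤ g (a - b) := hg.mono (by linarith)
    linarith
  · rcases le_total 0 a with ha | ha
    · have e := hg.odd b
      have ha' := hg.nonneg ha
      have hb' := hg.nonneg (neg_nonneg.2 hb)
      rcases le_total ((a - b) / 2) a with h | h
      · have := hg.mono h
        linarith
      · have := hg.mono (show (a - b) / 2 ≤ -b by linarith)
        linarith
    · have := hg.superadd (a := -a) (b := a - b) (by linarith) (by linarith)
      rw [show -a + (a - b) = -b by ring, hg.odd, hg.odd] at this
      have h2 : g ((a - b) / 2) ≤ g (a - b) := hg.mono (by linarith)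
      linarith

/-- A Lipschitz bound for `g` on `[-m, m]`, by convexity. -/
lemma sub_le_mul_slope (hg : IsDoublingDensity D g) {a b m : ℝ} (hm : 0 < m) (hab : b ≤ a)
    (ha : |a| ≤ m) (hb : |b| ≤ m) : g a - g b ≤ (a - b) * (2 * g (2 * m) / m) := by
  have hS : 0 ≤ g (2 * m) / m := div_nonneg (hg.nonneg (by linarith)) hm.le
  -- the case of nonnegative arguments, by comparing slopes of secants
  have key : ∀ x y : ℝ, 0 ≤ y → y ≤ x → x ≤ m → g x - g y ≤ (x - y) * (g (2 * m) / m) := by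
    intro x y hy hyx hxm
    rcases eq_or_lt_of_le hyx with rfl | hlt
    · simp
    have h1 := hg.convex.slope_mono_adjacent (x := y) (y := x) (z := 2 * m) (mem_Ici.2 hy)
      (mem_Ici.2 (by linarith)) hlt (by linarith)
    rw [div_le_iff₀ (by linarith)] at h1
    have h2 : (g (2 * m) - g x) / (2 * m - x) ≤ g (2 * m) / m := by
      apply div_le_div₀ (hg.nonneg (by linarith)) _ hm (by linarith)
      linarith [hg.nonneg (hy.trans hyx)]
    nlinarith
  rw [abs_le] at ha hb
  have e : 2 * g (2 * m) / m = g (2 * m) / m + g (2 * m) / m := by ring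
  rw [e]
  rcases le_total 0 b with hb0 | hb0
  · have := key a b hb0 hab ha.2
    nlinarith
  · rcases le_total 0 a with ha0 | ha0
    · have h1 := key a 0 le_rfl ha0 ha.2
      have h2 := key (-b) 0 le_rfl (by linarith) (by linarith)
      rw [hg.zero] at h1 h2
      rw [hg.odd] at h2
      nlinarith
    · have := key (-b) (-a) (by linarith) (by linarith) (by linarith)
      rw [hg.odd, hg.odd] at this
      nlinarith

lemma mul_self_nonneg (hg : IsDoublingDensity D g) (t : ℝ) : 0 ≤ t * g t := by
  rcases le_total 0 t with h | h
  · exact mul_nonneg h (hg.nonneg h)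
  · refine mul_nonneg_of_nonpos_of_nonpos h ?_
    rw [← hg.zero]; exact hg.mono h

lemma mul_self_abs (hg : IsDoublingDensity D g) (t : ℝ) : |t| * g |t| = t * g t := by
  rw [← hg.abs_apply, ← abs_mul, abs_of_nonneg (hg.mul_self_nonneg t)]

lemma mul_self_mono (hg : IsDoublingDensity D g) {a b : ℝ} (h : |a| ≤ |b|) :
    a * g a ≤ b * g b := by
  rw [← hg.mul_self_abs a, ← hg.mul_self_abs b]
  exact mul_le_mul h (hg.mono h) (hg.nonneg (abs_nonneg _)) (abs_nonneg _)

/-- Young's inequality in a crude form. -/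
lemma abs_apply_mul_le (hg : IsDoublingDensity D g) (a b : ℝ) :
    |g a * b| ≤ a * g a + b * g b := by
  rw [abs_mul, hg.abs_apply, ← hg.mul_self_abs a, ← hg.mul_self_abs b]
  have ha := hg.nonneg (abs_nonneg a)
  have hb := hg.nonneg (abs_nonneg b)
  rcases le_total |a| |b| with h | h
  · have := hg.mono h
    nlinarith [abs_nonneg a, abs_nonneg b]
  · nlinarith [abs_nonneg a, abs_nonneg b]

lemma mul_self_add_le (hg : IsDoublingDensity D g) (a b : ℝ) :
    (a + b) * g (a + b) ≤ 2 * D * (a * g a + b * g b) := by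
  have key : ∀ c : ℝ, |a + b| ≤ 2 * |c| → (a + b) * g (a + b) ≤ 2 * D * (c * g c) := by
    intro c hc
    rw [← hg.mul_self_abs (a + b), ← hg.mul_self_abs c]
    have h1 : g |a + b| ≤ D * g |c| := (hg.mono hc).trans (hg.doubling _ (abs_nonneg c))
    calc |a + b| * g |a + b| ≤ (2 * |c|) * (D * g |c|) :=
          mul_le_mul hc h1 (hg.nonneg (abs_nonneg _)) (by positivity)
      _ = _ := by ring
  have hD := hg.const_nonneg
  have ha := hg.mul_self_nonneg a
  have hb := hg.mul_self_nonneg b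
  have htri := abs_add_le a b
  rcases le_total |a| |b| with h | h
  · have := key b (by linarith)
    nlinarith
  · have := key a (by linarith)
    nlinarith

lemma young_le (hg : IsDoublingDensity D g) (t : ℝ) : young g t ≤ t * g t := by
  rw [← hg.mul_self_abs t, young]
  calc ∫ τ in (0 : ℝ)..|t|, g τ ≤ ∫ _ in (0 : ℝ)..|t|, g |t| :=
        intervalIntegral.integral_mono_on (abs_nonneg t) (hg.cont.intervalIntegrable _ _)
          intervalIntegrable_const fun x hx => hg.mono hx.2
    _ = |t| * g |t| := by simp

lemma mul_self_le_young (hg : IsDoublingDensity D g) (t : ℝ) : t * g t ≤ 2 * D * young g t := by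
  rw [← hg.mul_self_abs t, young]
  have ht := abs_nonneg t
  have h1 : ∫ _ in (|t| / 2)..|t|, g (|t| / 2) ≤ ∫ τ in (|t| / 2)..|t|, g τ :=
    intervalIntegral.integral_mono_on (by linarith) intervalIntegrable_const
      (hg.cont.intervalIntegrable _ _) fun x hx => hg.mono hx.1
  have h2 : 0 ≤ ∫ τ in (0 : ℝ)..(|t| / 2), g τ :=
    intervalIntegral.integral_nonneg (by linarith) fun x hx => hg.nonneg hx.1
  have h3 := intervalIntegral.integral_add_adjacent_intervals
    (hg.cont.intervalIntegrable (μ := volume) 0 (|t| / 2))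
    (hg.cont.intervalIntegrable (μ := volume) (|t| / 2) |t|)
  have h4 := hg.doubling (|t| / 2) (by linarith)
  rw [mul_div_cancel₀ _ (two_ne_zero)] at h4
  simp only [intervalIntegral.integral_const, smul_eq_mul] at h1
  have hD := hg.const_nonneg
  calc |t| * g |t| ≤ |t| * (D * g (|t| / 2)) := mul_le_mul_of_nonneg_left h4 ht
    _ = 2 * D * ((|t| - |t| / 2) * g (|t| / 2)) := by ring
    _ ≤ 2 * D * ∫ τ in (0 : ℝ)..|t|, g τ := by
        apply mul_le_mul_of_nonneg_left _ (by positivity)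
        linarith

lemma ginv_spec (hg : IsDoublingDensity D g) {y : ℝ} (hy : 0 ≤ y) :
    0 ≤ ginv g y ∧ g (ginv g y) = y := by
  have : ∃ x ∈ Ici (0 : ℝ), g x = y := by
    obtain ⟨T, hT0, hT⟩ := ((eventually_ge_atTop (0 : ℝ)).and
      (hg.tendsto.eventually (eventually_ge_atTop y))).exists
    obtain ⟨x, hx, hxy⟩ := intermediate_value_Icc hT0 hg.cont.continuousOn
      (show y ∈ Icc (g 0) (g T) from ⟨by rwa [hg.zero], hT⟩)
    exact ⟨x, hx.1, hxy⟩
  exact ⟨Function.invFunOn_mem this, Function.invFunOn_eq this⟩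

end IsDoublingDensity

namespace IsAdmissible

variable {lam Lam : ℝ} {g : ℝ → ℝ}

lemma apply_nonneg (hg : IsAdmissible lam Lam g) {t : ℝ} (ht : 0 ≤ t) : 0 ≤ g t := by
  rcases eq_or_lt_of_le ht with rfl | h
  · exact hg.zero.ge
  · exact (hg.pos t h).le

lemma monotone (hg : IsAdmissible lam Lam g) : Monotone g := by
  have key : ∀ a b, 0 ≤ a → a ≤ b → g a ≤ g b := by
    intro a b ha hab
    rcases eq_or_lt_of_le ha with rfl | h
    · rw [hg.zero]; exact hg.apply_nonneg hab
    · exact hg.mono h (h.trans_le hab) hab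
  intro a b hab
  rcases le_total 0 a with ha | ha
  · exact key a b ha hab
  · rcases le_total 0 b with hb | hb
    · have h1 := hg.odd a
      have h2 := hg.apply_nonneg (neg_nonneg.2 ha)
      have h3 := hg.apply_nonneg hb
      linarith
    · have := key (-b) (-a) (by linarith) (by linarith)
      rw [hg.odd, hg.odd] at this
      linarith

lemma continuous (hg : IsAdmissible lam Lam g) : Continuous g := by
  rw [continuous_iff_continuousAt]
  have hpos : ∀ t, 0 < t → ContinuousAt g t := fun t ht =>
    (hg.convex.continuousOn isOpen_Ioi).continuousAt (isOpen_Ioi.mem_nhds ht)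
  have hneg : g = fun t => -g (-t) := by
    funext t; rw [hg.odd]; ring
  intro t
  rcases lt_trichotomy t 0 with h | rfl | h
  · rw [hneg]
    exact ((hpos (-t) (by linarith)).comp' continuous_neg.continuousAt).neg
  · have h1 : ContinuousWithinAt g (Ici 0) 0 := hg.rightCont 0 le_rfl
    have h2 : ContinuousWithinAt g (Iic 0) 0 := by
      rw [hneg]
      have : ContinuousWithinAt g (Ici 0) (-0) := by simpa using h1
      exact (this.comp continuous_neg.continuousWithinAt
        (fun x (hx : x ≤ 0) => mem_Ici.2 (by linarith))).neg
    have := h2.union h1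
    rwa [Iic_union_Ici, continuousWithinAt_univ] at this
  · exact hpos t h

lemma convexOn_Ici (hg : IsAdmissible lam Lam g) : ConvexOn ℝ (Ici 0) g := by
  refine ⟨convex_Ici 0, fun x hx y hy a b ha hb hab => ?_⟩
  have hl : Tendsto (fun e : ℝ => g (a • (x + e) + b • (y + e))) (𝓝[>] 0)
      (𝓝 (g (a • (x + 0) + b • (y + 0)))) :=
    (hg.continuous.comp (by fun_prop :
      Continuous fun e : ℝ => a • (x + e) + b • (y + e))).continuousAt.mono_left
        nhdsWithin_le_nhds
  have hr : Tendsto (fun e : ℝ => a • g (x + e) + b • g (y + e)) (𝓝[>] 0)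
      (𝓝 (a • g (x + 0) + b • g (y + 0))) :=
    (by have := hg.continuous
        fun_prop : Continuous fun e : ℝ => a • g (x + e) + b • g (y + e)).continuousAt.mono_left
        nhdsWithin_le_nhds
  simp only [add_zero] at hl hr
  refine le_of_tendsto_of_tendsto hl hr ?_
  filter_upwards [self_mem_nhdsWithin] with e he
  have he : 0 < e := he
  have hx : 0 ≤ x := hx
  have hy : 0 ≤ y := hy
  exact hg.convex.2 (mem_Ioi.2 (by linarith)) (mem_Ioi.2 (by linarith)) ha hb hab

/-- The bound `t g'(t) ≤ Lam g(t)` allows `g` to grow at most by a factor `2` when its argument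
grows by the factor `1 + 1 / (2 Lam)`. -/
lemma apply_step_le (hg : IsAdmissible lam Lam g) (hLam : 0 < Lam) {t : ℝ} (ht : 0 < t) :
    g ((1 + 1 / (2 * Lam)) * t) ≤ 2 * g t := by
  set b := (1 + 1 / (2 * Lam)) * t with hb
  have hbt : b - t = t / (2 * Lam) := by rw [hb]; field_simp; ring
  have htb : t ≤ b := by
    have : 0 < t / (2 * Lam) := by positivity
    linarith
  have hac : AbsolutelyContinuousOnInterval g t b :=
    (hg.absCont b (ht.trans_le htb)).mono (by
      rw [uIcc_of_le htb, uIcc_of_le (ht.le.trans htb)]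
      exact Icc_subset_Icc_left ht.le)
  have hint := hac.integral_deriv_eq_sub
  have hle : ∫ x in t..b, deriv g x ≤ ∫ _ in t..b, Lam * g b / t := by
    apply intervalIntegral.integral_mono_ae_restrict htb hac.intervalIntegrable_deriv
      intervalIntegrable_const
    have h1 : ∀ᵐ x ∂(volume.restrict (Icc t b)),
        lam ≤ x * deriv g x / g x ∧ x * deriv g x / g x ≤ Lam :=
      ae_mono (Measure.restrict_mono (fun x hx => mem_Ioi.2 (ht.trans_le hx.1)) le_rfl) hg.elliptic
    filter_upwards [h1, ae_restrict_mem measurableSet_Icc] with x hx hxm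
    have hx0 : 0 < x := ht.trans_le hxm.1
    have h2 := hx.2
    rw [div_le_iff₀ (hg.pos x hx0)] at h2
    show deriv g x ≤ Lam * g b / t
    rw [le_div_iff₀ ht]
    have h3 : g x ≤ g b := hg.monotone hxm.2
    have h4 : Lam * g x ≤ Lam * g b := by gcongr
    rcases le_total 0 (deriv g x) with h | h
    · have := hxm.1
      nlinarith
    · have := hg.pos b (ht.trans_le htb)
      nlinarith [mul_pos hLam this]
  rw [hint, intervalIntegral.integral_const, hbt, smul_eq_mul] at hle
  have : t / (2 * Lam) * (Lam * g b / t) = g b / 2 := by field_simp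
  linarith

/-- The doubling constant determined by the upper growth exponent `Lam`. -/
def doublingConst (Lam : ℝ) : ℝ := 2 ^ ⌈2 * Lam⌉₊

theorem isDoublingDensity (hg : IsAdmissible lam Lam g) (hlam : 1 < lam) :
    IsDoublingDensity (doublingConst Lam) g := by
  have hLam : 0 < Lam := by
    have hne : (ae (volume.restrict (Ioi (0 : ℝ)))).NeBot := by
      rw [ae_neBot, Ne, Measure.restrict_eq_zero]; simp
    obtain ⟨t, ht⟩ := hg.elliptic.exists
    linarith
  refine ⟨hg.odd, hg.pos, hg.monotone, hg.continuous, hg.convexOn_Ici, ?_, hg.tendsto⟩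
  intro t ht
  rcases eq_or_lt_of_le ht with rfl | ht
  · simp [hg.zero]
  have key : ∀ m : ℕ, g ((1 + 1 / (2 * Lam)) ^ m * t) ≤ 2 ^ m * g t := by
    intro m
    induction m with
    | zero => simp
    | succ k ih =>
      have := hg.apply_step_le hLam (t := (1 + 1 / (2 * Lam)) ^ k * t) (by positivity)
      rw [pow_succ', pow_succ', mul_assoc, mul_assoc]
      linarith
  refine le_trans (hg.monotone ?_) (key ⌈2 * Lam⌉₊)
  refine mul_le_mul_of_nonneg_right ?_ ht.le
  -- Bernoulli's inequality
  have h1 := one_add_mul_le_pow (a := 1 / (2 * Lam))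
    (by have : 0 < 1 / (2 * Lam) := by positivity
        linarith) ⌈2 * Lam⌉₊
  have h2 : 1 ≤ (⌈2 * Lam⌉₊ : ℝ) * (1 / (2 * Lam)) := by
    rw [mul_one_div, le_div_iff₀ (by positivity)]
    linarith [Nat.le_ceil (2 * Lam)]
  linarith

end IsAdmissible

/-! ### Radial kernels and antisymmetric nonlocal forms -/

/-- The radial kernel equal to `|z|^(α - n)` in the unit ball and to `|z|^(-β - n)` outside. -/
def radialKernel (n : ℕ) (α β : ℝ) (z : E n) : ℝ :=
  if ‖z‖ ≤ 1 then ‖z‖ ^ (α - n) else ‖z‖ ^ (-β - n)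

lemma radialKernel_nonneg (n : ℕ) (α β : ℝ) (z : E n) : 0 ≤ radialKernel n α β z := by
  unfold radialKernel; split_ifs <;> positivity

lemma integrable_radialKernel {n : ℕ} (hn : 1 ≤ n) {α β : ℝ} (hα : 0 < α) (hβ : 0 < β) :
    Integrable (radialKernel n α β) := by
  have hn0 : (0 : ℝ) < n := by exact_mod_cast hn
  have : Nonempty (Fin n) := ⟨⟨0, hn⟩⟩
  have hpow : ∀ y : ℝ, 0 < y → ∀ γ : ℝ, y ^ (n - 1) • y ^ (γ - n) = y ^ (γ - 1) := by
    intro y hy γ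
    rw [smul_eq_mul, ← Real.rpow_natCast, ← Real.rpow_add hy, Nat.cast_sub hn]
    congr 1; push_cast; ring
  have := (integrable_fun_norm_addHaar (volume : Measure (E n))
    (f := fun r : ℝ => if r ≤ 1 then r ^ (α - n) else r ^ (-β - n))).2 ?_
  · exact this
  rw [finrank_euclideanSpace_fin, ← Ioc_union_Ioi_eq_Ioi zero_le_one]
  refine IntegrableOn.union ?_ ?_
  · have h : IntegrableOn (fun y : ℝ => y ^ (α - 1)) (Ioc 0 1) := by
      rw [integrableOn_Ioc_iff_integrableOn_Ioo, intervalIntegral.integrableOn_Ioo_rpow_iff one_pos]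
      linarith
    refine h.congr_fun (fun y hy => ?_) measurableSet_Ioc
    simp only [if_pos hy.2]
    exact (hpow y hy.1 α).symm
  · have h : IntegrableOn (fun y : ℝ => y ^ (-β - 1)) (Ioi 1) :=
      integrableOn_Ioi_rpow_of_lt (by linarith) one_pos
    refine h.congr_fun (fun y hy => ?_) measurableSet_Ioi
    simp only [if_neg (not_le.2 (mem_Ioi.1 hy))]
    exact (hpow y (one_pos.trans hy) (-β)).symm

/-- A form with an antisymmetric kernel `k`, singular on the diagonal, is bounded above on
nonnegative functions as soon as the symmetrized kernel `k (x, x + z) + k (x, x - z)` is bounded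
above by an integrable function of `z`. The integral is truncated away from the diagonal, where
both halves of the form are integrable and can be symmetrized. -/
theorem integral_antisymm_le {n : ℕ} {k : E n × E n → ℝ} (hk : Measurable k)
    (hanti : ∀ x y, k (y, x) = -k (x, y))
    (htrunc : ∀ ε : ℝ, 0 < ε → ∃ ρ : E n → ℝ, Integrable ρ ∧
      ∀ x z, ε < ‖z‖ → |k (x, x + z)| ≤ ρ z)
    {ψ : E n → ℝ} (hψ : Integrable ψ) (hψ0 : ∀ z, 0 ≤ ψ z)
    (hsymm : ∀ x z, k (x, x + z) + k (x, x - z) ≤ ψ z)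
    {φ : E n → ℝ} (hφ : Integrable φ) (hφ0 : ∀ x, 0 ≤ φ x)
    (hint : Integrable (fun p : E n × E n => k p * (φ p.1 - φ p.2))) :
    ∫ p : E n × E n, k p * (φ p.1 - φ p.2) ≤ (∫ z, ψ z) * ∫ x, φ x := by
  have key : ∀ ε : ℝ, 0 < ε →
      ∫ p : E n × E n, {p : E n × E n | ε < ‖p.2 - p.1‖}.indicator
        (fun p => k p * (φ p.1 - φ p.2)) p ≤ (∫ z, ψ z) * ∫ x, φ x := by
    intro ε hε
    set S : Set (E n × E n) := {p | ε < ‖p.2 - p.1‖} with hS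
    have hSm : MeasurableSet S := measurableSet_lt measurable_const (by fun_prop)
    set f : E n × E n → ℝ := fun p => S.indicator k p * φ p.1 with hf
    set T : E n × E n → E n × E n := fun p => (p.1, p.1 + p.2) with hT
    have hTmp : MeasurePreserving T (volume : Measure (E n × E n)) volume :=
      measurePreserving_prod_add (volume : Measure (E n)) (volume : Measure (E n))
    have hTe : MeasurableEmbedding T := (MeasurableEquiv.shearAddRight (E n)).measurableEmbedding
    have hN : MeasurePreserving (fun p : E n × E n => (p.1, -p.2))
        (volume : Measure (E n × E n)) volume :=
      (MeasurePreserving.id volume).prod (Measure.measurePreserving_neg (volume : Measure (E n)))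
    have hNe : MeasurableEmbedding (fun p : E n × E n => (p.1, -p.2)) :=
      ((MeasurableEquiv.refl (E n)).prodCongr (MeasurableEquiv.neg (E n))).measurableEmbedding
    have hsw : MeasurePreserving (Prod.swap : E n × E n → E n × E n)
        (volume : Measure (E n × E n)) volume := Measure.measurePreserving_swap
    have hswe : MeasurableEmbedding (Prod.swap : E n × E n → E n × E n) :=
      MeasurableEquiv.prodComm.measurableEmbedding
    have hfst : AEStronglyMeasurable (fun p : E n × E n => φ p.1) volume :=
      hφ.aestronglyMeasurable.comp_fst
    have hfm : AEStronglyMeasurable f volume :=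
      ((hk.indicator hSm).aestronglyMeasurable).mul hfst
    obtain ⟨ρ, hρ, hρk⟩ := htrunc ε hε
    have hFT : Integrable (f ∘ T) := by
      refine Integrable.mono' (hφ.mul_prod hρ.abs) (hfm.comp_measurePreserving hTmp) ?_
      refine Eventually.of_forall fun p => ?_
      simp only [hf, hT, Function.comp, norm_mul, Real.norm_eq_abs, abs_of_nonneg (hφ0 p.1)]
      rw [mul_comm]
      refine mul_le_mul_of_nonneg_left ?_ (hφ0 _)
      by_cases h : (p.1, p.1 + p.2) ∈ S
      · rw [indicator_of_mem h]
        simp only [hS, mem_ofPred_eq, add_sub_cancel_left] at h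
        exact (hρk _ _ h).trans (le_abs_self _)
      · rw [indicator_of_notMem h, abs_zero]; exact abs_nonneg _
    have hfi : Integrable f := (hTmp.integrable_comp_emb hTe).1 hFT
    have hfs : Integrable (f ∘ Prod.swap) := (hsw.integrable_comp_emb hswe).2 hfi
    have hFN : Integrable ((f ∘ T) ∘ fun p : E n × E n => (p.1, -p.2)) :=
      (hN.integrable_comp_emb hNe).2 hFT
    have e1 : ∫ p, S.indicator (fun p => k p * (φ p.1 - φ p.2)) p =
        ∫ p, f p + (f ∘ Prod.swap) p := by
      refine integral_congr_ae (Eventually.of_forall fun p => ?_)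
      obtain ⟨x, y⟩ := p
      by_cases h : (x, y) ∈ S
      · have h' : (y, x) ∈ S := by
          simp only [hS, mem_ofPred_eq] at h ⊢; rwa [norm_sub_rev]
        simp only [hf, Function.comp, Prod.swap, indicator_of_mem h, indicator_of_mem h',
          hanti x y]
        ring
      · have h' : (y, x) ∉ S := by
          simp only [hS, mem_ofPred_eq] at h ⊢; rwa [norm_sub_rev]
        simp [hf, Function.comp, Prod.swap, indicator_of_notMem h, indicator_of_notMem h']
    have e2 : ∫ p, (f ∘ Prod.swap) p = ∫ p, f p := hsw.integral_comp hswe f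
    have e3 : ∫ p, (f ∘ T) p = ∫ p, f p := hTmp.integral_comp hTe f
    have e4 : ∫ p, ((f ∘ T) ∘ fun p : E n × E n => (p.1, -p.2)) p = ∫ p, (f ∘ T) p :=
      hN.integral_comp hNe (f ∘ T)
    rw [e1, integral_add hfi hfs, e2, ← e3]
    nth_rewrite 2 [← e4]
    rw [← integral_add hFT hFN, mul_comm, ← integral_prod_mul φ ψ]
    refine integral_mono (hFT.add hFN) (hφ.mul_prod hψ) fun p => ?_
    obtain ⟨x, z⟩ := p
    simp only [hf, hT, Function.comp, ← sub_eq_add_neg]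
    rw [← add_mul, mul_comm]
    refine mul_le_mul_of_nonneg_left ?_ (hφ0 x)
    by_cases h : ε < ‖z‖
    · have h1 : (x, x + z) ∈ S := by simpa [hS] using h
      have h2 : (x, x - z) ∈ S := by simpa [hS] using h
      rw [indicator_of_mem h1, indicator_of_mem h2]
      exact hsymm x z
    · have h1 : (x, x + z) ∉ S := by simpa [hS] using h
      have h2 : (x, x - z) ∉ S := by simpa [hS] using h
      rw [indicator_of_notMem h1, indicator_of_notMem h2, add_zero]
      exact hψ0 z
  have hlim : Tendsto (fun m : ℕ => ∫ p : E n × E n,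
      {p : E n × E n | 1 / ((m : ℝ) + 1) < ‖p.2 - p.1‖}.indicator
        (fun p => k p * (φ p.1 - φ p.2)) p) atTop
      (𝓝 (∫ p : E n × E n, k p * (φ p.1 - φ p.2))) := by
    refine tendsto_integral_of_dominated_convergence
      (fun p => ‖k p * (φ p.1 - φ p.2)‖) (fun m => ?_) hint.norm (fun m => ?_) ?_
    · exact hint.aestronglyMeasurable.indicator
        (measurableSet_lt measurable_const (by fun_prop))
    · exact Eventually.of_forall fun p => norm_indicator_le_norm_self _ _
    · refine Eventually.of_forall fun p => ?_
      by_cases h : p.1 = p.2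
      · have : ∀ m : ℕ, {p : E n × E n | 1 / ((m : ℝ) + 1) < ‖p.2 - p.1‖}.indicator
            (fun p => k p * (φ p.1 - φ p.2)) p = k p * (φ p.1 - φ p.2) := by
          intro m
          by_cases hm : p ∈ {p : E n × E n | 1 / ((m : ℝ) + 1) < ‖p.2 - p.1‖}
          · rw [indicator_of_mem hm]
          · rw [indicator_of_notMem hm, h]; simp
        simp only [this]
        exact tendsto_const_nhds
      · have hpos : 0 < ‖p.2 - p.1‖ := norm_pos_iff.2 (sub_ne_zero.2 (Ne.symm h))
        refine tendsto_const_nhds.congr' ?_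
        filter_upwards [tendsto_one_div_add_atTop_nhds_zero_nat.eventually
          (gt_mem_nhds hpos)] with m hm
        exact (indicator_of_mem (s := {p : E n × E n | 1 / ((m : ℝ) + 1) < ‖p.2 - p.1‖}) hm
          (fun p => k p * (φ p.1 - φ p.2))).symm
  exact le_of_tendsto hlim (Eventually.of_forall fun m => key _ (by positivity))

/-! ### The barrier -/

/-- The truncated paraboloid `(144/7) (1/9 - |x|²/R²)₊`, a semiconvex barrier profile which is at
least `1` on `B_{R/4}` and vanishes outside `B_{R/3}`. -/
def barrier {n : ℕ} (R : ℝ) (x : E n) : ℝ := 144 / 7 * max 0 (1 / 9 - (‖x‖ / R) ^ 2)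

section barrier

variable {n : ℕ} {R : ℝ}

lemma continuous_barrier : Continuous (barrier (n := n) R) := by
  unfold barrier; fun_prop

lemma barrier_nonneg (x : E n) : 0 ≤ barrier R x := by unfold barrier; positivity

lemma barrier_le (x : E n) : barrier R x ≤ 3 := by
  have h : max 0 (1 / 9 - (‖x‖ / R) ^ 2) ≤ 1 / 9 :=
    max_le (by norm_num) (by have := sq_nonneg (‖x‖ / R); linarith)
  unfold barrier; linarith

lemma barrier_eq_zero (hR : 0 < R) {x : E n} (hx : x ∉ Metric.ball (0 : E n) (R / 3)) :
    barrier R x = 0 := by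
  rw [mem_ball_zero_iff, not_lt] at hx
  have : 1 / 3 ≤ ‖x‖ / R := by rw [le_div_iff₀ hR]; linarith
  rw [barrier, max_eq_left (by nlinarith), mul_zero]

lemma one_le_barrier (hR : 0 < R) {x : E n} (hx : x ∈ Metric.ball (0 : E n) (R / 4)) :
    1 ≤ barrier R x := by
  rw [mem_ball_zero_iff] at hx
  have h1 : ‖x‖ / R ≤ 1 / 4 := by rw [div_le_iff₀ hR]; linarith
  have h0 : 0 ≤ ‖x‖ / R := by positivity
  have h2 := le_max_right 0 (1 / 9 - (‖x‖ / R) ^ 2)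
  unfold barrier
  nlinarith

lemma abs_barrier_sub_le (hR : 0 < R) (x y : E n) :
    |barrier R x - barrier R y| ≤ 14 * (‖x - y‖ / R) := by
  have key : ∀ x : E n, max 0 (1 / 9 - (‖x‖ / R) ^ 2) = 1 / 9 - (min (‖x‖ / R) (1 / 3)) ^ 2 := by
    intro x
    have h0 : 0 ≤ ‖x‖ / R := by positivity
    rcases le_total (‖x‖ / R) (1 / 3) with h | h
    · rw [min_eq_left h, max_eq_right (by nlinarith)]
    · rw [min_eq_right h, max_eq_left (by nlinarith)]; norm_num
  have hx : 0 ≤ ‖x‖ / R := by positivity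
  have hy : 0 ≤ ‖y‖ / R := by positivity
  unfold barrier
  rw [key, key]
  set a := min (‖x‖ / R) (1 / 3) with ha
  set b := min (‖y‖ / R) (1 / 3) with hb
  have ha0 : 0 ≤ a := le_min hx (by norm_num)
  have hb0 : 0 ≤ b := le_min hy (by norm_num)
  have ha1 : a ≤ 1 / 3 := min_le_right _ _
  have hb1 : b ≤ 1 / 3 := min_le_right _ _
  have hab : |a - b| ≤ ‖x - y‖ / R := by
    have h1 : |a - b| ≤ |‖x‖ / R - ‖y‖ / R| := by
      have := abs_min_sub_min_le_max (‖x‖ / R) (1 / 3) (‖y‖ / R) (1 / 3)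
      simpa [ha, hb] using this
    refine h1.trans ?_
    rw [← sub_div, abs_div, abs_of_pos hR]
    gcongr
    exact abs_norm_sub_norm_le x y
  have e : 144 / 7 * (1 / 9 - a ^ 2) - 144 / 7 * (1 / 9 - b ^ 2) = -(144 / 7 * (a + b) * (a - b)) := by
    ring
  rw [e, abs_neg, abs_mul, abs_of_nonneg (by positivity)]
  calc 144 / 7 * (a + b) * |a - b| ≤ 14 * |a - b| :=
        mul_le_mul_of_nonneg_right (by linarith) (abs_nonneg _)
    _ ≤ _ := by linarith

/-- A one-sided bound on second differences, which holds since the barrier is a maximum of two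
functions whose second derivatives are bounded below. -/
lemma barrier_second_difference_le (x z : E n) :
    2 * barrier R x - barrier R (x + z) - barrier R (x - z) ≤ 42 * (‖z‖ / R) ^ 2 := by
  have hp := parallelogram_law_with_norm ℝ x z
  have e : (‖x + z‖ / R) ^ 2 + (‖x - z‖ / R) ^ 2 = 2 * (‖x‖ / R) ^ 2 + 2 * (‖z‖ / R) ^ 2 := by
    simp only [div_pow, ← add_div, ← mul_div_assoc]
    congr 1; linarith
  have h1 := le_max_right 0 (1 / 9 - (‖x + z‖ / R) ^ 2)
  have h2 := le_max_right 0 (1 / 9 - (‖x - z‖ / R) ^ 2)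
  have h3 := le_max_left 0 (1 / 9 - (‖x + z‖ / R) ^ 2)
  have h4 := le_max_left 0 (1 / 9 - (‖x - z‖ / R) ^ 2)
  have hz : 0 ≤ (‖z‖ / R) ^ 2 := sq_nonneg _
  unfold barrier
  rcases max_cases 0 (1 / 9 - (‖x‖ / R) ^ 2) with ⟨h, -⟩ | ⟨h, -⟩ <;> rw [h] <;> linarith

end barrier

section kernel

variable {n : ℕ} {s R : ℝ}

lemma radialKernel_scaled_of_le (hR : 0 < R) (α : ℝ) {z : E n} (hz : ‖z‖ ≤ R) :
    radialKernel n α s (R⁻¹ • z) = (‖z‖ / R) ^ (α - n) := by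
  have : ‖R⁻¹ • z‖ = ‖z‖ / R := by
    rw [norm_smul, norm_inv, Real.norm_of_nonneg hR.le]; ring
  rw [radialKernel, this, if_pos ((div_le_one hR).2 hz)]

/-- Outside `B_R` the scaled kernel is a multiple of `|z|^(-n - s)`, whatever `α` is. -/
lemma radialKernel_scaled_of_lt (hR : 0 < R) (α : ℝ) {z : E n} (hz : R < ‖z‖) :
    radialKernel n α s (R⁻¹ • z) = (R ^ s * R ^ n) / (‖z‖ ^ s * ‖z‖ ^ n) := by
  have : ‖R⁻¹ • z‖ = ‖z‖ / R := by
    rw [norm_smul, norm_inv, Real.norm_of_nonneg hR.le]; ring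
  have hz0 := hR.trans hz
  rw [radialKernel, this, if_neg (not_le.2 ((one_lt_div hR).2 hz)), ← neg_add',
    Real.rpow_neg (by positivity), Real.rpow_add (by positivity), Real.rpow_natCast,
    Real.div_rpow hz0.le hR.le, div_pow]
  field_simp

lemma integrable_radialKernel_scaled (hn : 1 ≤ n) (hR : 0 < R) {α β : ℝ} (hα : 0 < α)
    (hβ : 0 < β) : Integrable (fun z : E n => radialKernel n α β (R⁻¹ • z)) :=
  (integrable_radialKernel hn hα hβ).comp_smul (inv_ne_zero hR.ne')

lemma integral_radialKernel_scaled (hR : 0 < R) (α β : ℝ) :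
    ∫ z : E n, radialKernel n α β (R⁻¹ • z) = R ^ n * ∫ z : E n, radialKernel n α β z := by
  rw [Measure.integral_comp_inv_smul_of_nonneg _ _ hR.le, finrank_euclideanSpace_fin, smul_eq_mul]

/-- The barrier of height `h`. -/
def scaledBarrier (R h : ℝ) (x : E n) : ℝ := h * barrier R x

/-- The kernel of the nonlocal form of the barrier with respect to Lebesgue measure. -/
def barrierKernel (g : ℝ → ℝ) (s R h : ℝ) (p : E n × E n) : ℝ :=
  g (holderQuot s (scaledBarrier R h) p) / (‖p.1 - p.2‖ ^ s * ‖p.1 - p.2‖ ^ n)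

lemma measurable_scaledBarrier (R h : ℝ) : Measurable (scaledBarrier (n := n) R h) :=
  (continuous_barrier.measurable).const_mul h

lemma measurable_holderQuot {u : E n → ℝ} (hu : Measurable u) : Measurable (holderQuot s u) := by
  unfold holderQuot
  exact ((hu.comp measurable_fst).sub (hu.comp measurable_snd)).div
    ((measurable_fst.sub measurable_snd).norm.pow_const s)

variable {D : ℝ} {g : ℝ → ℝ}

lemma measurable_barrierKernel (hg : IsDoublingDensity D g) (s R h : ℝ) :
    Measurable (barrierKernel (n := n) g s R h) := by
  unfold barrierKernel
  exact (hg.cont.measurable.comp (measurable_holderQuot (measurable_scaledBarrier R h))).div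
    (((measurable_fst.sub measurable_snd).norm.pow_const s).mul
      ((measurable_fst.sub measurable_snd).norm.pow_const n))

lemma abs_holderQuot_barrier_le (h : ℝ) (hh : 0 ≤ h) (x z : E n) :
    |holderQuot s (scaledBarrier R h) (x, x + z)| ≤ 3 * h / ‖z‖ ^ s := by
  have e : x - (x + z) = -z := by abel
  simp only [holderQuot, e, norm_neg, scaledBarrier]
  rw [abs_div, abs_of_nonneg (a := ‖z‖ ^ s) (by positivity), ← mul_sub, abs_mul, abs_of_nonneg hh,
    mul_comm 3]
  gcongr
  rw [abs_le]
  have := barrier_nonneg (R := R) x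
  have := barrier_nonneg (R := R) (x + z)
  have := barrier_le (R := R) x
  have := barrier_le (R := R) (x + z)
  constructor <;> linarith

lemma abs_holderQuot_barrier_le' (hR : 0 < R) {h : ℝ} (hh : 0 ≤ h) (x : E n) {z : E n}
    (hz : z ≠ 0) : |holderQuot s (scaledBarrier R h) (x, x + z)| ≤
      14 * (h * R ^ (-s)) * (‖z‖ / R) ^ (1 - s) := by
  have hz0 : 0 < ‖z‖ := norm_pos_iff.2 hz
  have e : x - (x + z) = -z := by abel
  have e2 : h * R ^ (-s) * (‖z‖ / R) ^ (1 - s) = h * (‖z‖ / R) / ‖z‖ ^ s := by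
    rw [Real.rpow_sub (by positivity), Real.rpow_one, Real.div_rpow hz0.le hR.le,
      Real.rpow_neg hR.le]
    field_simp
  rw [mul_assoc, e2]
  simp only [holderQuot, e, norm_neg, scaledBarrier]
  rw [abs_div, abs_of_nonneg (a := ‖z‖ ^ s) (by positivity), ← mul_sub, abs_mul, abs_of_nonneg hh,
    ← mul_div_assoc]
  have := abs_barrier_sub_le hR x (x + z)
  rw [e, norm_neg] at this
  refine div_le_div_of_nonneg_right ?_ (by positivity)
  linarith [mul_le_mul_of_nonneg_left this hh]

/-- Pointwise bound for the symmetrized kernel of the barrier. Near the diagonal it combines the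
one-sided second difference bound with the Lipschitz bound for `g`. -/
lemma barrierKernel_symm_le (hg : IsDoublingDensity D g) (hs1 : s < 1) (hs0 : 0 < s)
    (hR : 0 < R) {h : ℝ} (hh : 0 < h) (x z : E n) :
    barrierKernel g s R h (x, x + z) + barrierKernel g s R h (x, x - z) ≤
      (6 * growthConst D 28 + 2 * growthConst D 3) * g (h * R ^ (-s)) / (R ^ s * R ^ n) *
        radialKernel n (2 - 2 * s) s (R⁻¹ • z) := by
  set H := h * R ^ (-s) with hH
  have hH0 : 0 < H := by positivity
  have hgH := hg.nonneg hH0.le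
  have hC28 := growthConst_pos D 28
  have hC3 := growthConst_pos D 3
  have hrk := radialKernel_nonneg n (2 - 2 * s) s (R⁻¹ • z)
  rcases eq_or_ne z 0 with rfl | hz
  · have : barrierKernel g s R h (x, x) = 0 := by
      simp [barrierKernel, holderQuot, hg.zero]
    simp only [add_zero, sub_zero, this]
    positivity
  have hz0 : 0 < ‖z‖ := norm_pos_iff.2 hz
  have e1 : x - (x + z) = -z := by abel
  have e2 : x - (x - z) = z := by abel
  set a := holderQuot s (scaledBarrier R h) (x, x + z) with ha
  set b := -holderQuot s (scaledBarrier R h) (x, x - z) with hb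
  have hsum : barrierKernel g s R h (x, x + z) + barrierKernel g s R h (x, x - z) =
      (g a - g b) / (‖z‖ ^ s * ‖z‖ ^ n) := by
    simp only [barrierKernel, e1, e2, norm_neg, ← ha]
    rw [hb, hg.odd]; ring
  rw [hsum]
  have hx : x - z = x + -z := by abel
  rcases le_or_gt ‖z‖ R with hzR | hzR
  · rw [radialKernel_scaled_of_le hR _ hzR]
    set τ := ‖z‖ / R with hτ
    have hτ0 : 0 < τ := by positivity
    have hτ1 : τ ≤ 1 := (div_le_one hR).2 hzR
    have hzτ : ‖z‖ = τ * R := by rw [hτ]; field_simp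
    have key : g a - g b ≤ 6 * growthConst D 28 * τ ^ (2 - s) * g H := by
      have hR0 : 0 ≤ 6 * growthConst D 28 * τ ^ (2 - s) * g H := by positivity
      rcases le_total a b with hab | hab
      · have := hg.mono hab
        linarith
      set m := 14 * H * τ ^ (1 - s) with hm
      have hm0 : 0 < m := by positivity
      have ham : |a| ≤ m := abs_holderQuot_barrier_le' hR hh.le x hz
      have hbm : |b| ≤ m := by
        have := abs_holderQuot_barrier_le' (s := s) hR hh.le x (neg_ne_zero.2 hz)
        rw [norm_neg, ← hx] at this
        rw [hb, abs_neg]; exact this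
      have hsl := hg.sub_le_mul_slope hm0 hab ham hbm
      have hdiff : a - b ≤ 42 * H * τ ^ (2 - s) := by
        have hd := barrier_second_difference_le (R := R) x z
        have e3 : 42 * H * τ ^ (2 - s) = h * (42 * τ ^ 2) / ‖z‖ ^ s := by
          rw [Real.rpow_sub hτ0, hzτ, Real.mul_rpow hτ0.le hR.le, hH, Real.rpow_neg hR.le]
          norm_num
          field_simp
        have e4 : a - b = h * (2 * barrier R x - barrier R (x + z) - barrier R (x - z)) /
            ‖z‖ ^ s := by
          rw [ha, hb]
          simp only [holderQuot, e1, e2, norm_neg, scaledBarrier]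
          ring
        rw [e3, e4]
        gcongr
      have hg2m : g (2 * m) ≤ τ ^ (1 - s) * (growthConst D 28 * g H) := by
        rw [show 2 * m = τ ^ (1 - s) * (28 * H) by rw [hm]; ring]
        refine (hg.apply_mul_le (by positivity)
          (Real.rpow_le_one hτ0.le hτ1 (by linarith)) (by positivity)).trans ?_
        gcongr
        exact hg.apply_mul_le_growthConst 28 hH0.le
      have h2m := hg.nonneg (t := 2 * m) (by positivity)
      calc g a - g b ≤ (a - b) * (2 * g (2 * m) / m) := hsl
        _ ≤ (42 * H * τ ^ (2 - s)) * (2 * (τ ^ (1 - s) * (growthConst D 28 * g H)) / m) := by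
            gcongr
        _ = 6 * growthConst D 28 * τ ^ (2 - s) * g H := by
            rw [hm]; field_simp; ring
    have e5 : ‖z‖ ^ s * ‖z‖ ^ n = (R ^ s * R ^ n) * (τ ^ s * τ ^ (n : ℝ)) := by
      rw [hzτ, Real.mul_rpow hτ0.le hR.le, mul_pow, Real.rpow_natCast]; ring
    have e6 : τ ^ (2 - 2 * s - n) = τ ^ (2 - s) / (τ ^ s * τ ^ (n : ℝ)) := by
      rw [← Real.rpow_add hτ0, ← Real.rpow_sub hτ0]; congr 1; ring
    rw [e5, e6, div_le_iff₀ (by positivity)]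
    refine key.trans ?_
    have e7 : (6 * growthConst D 28 + 2 * growthConst D 3) * g H / (R ^ s * R ^ n) *
        (τ ^ (2 - s) / (τ ^ s * τ ^ (n : ℝ))) * ((R ^ s * R ^ n) * (τ ^ s * τ ^ (n : ℝ))) =
        (6 * growthConst D 28 + 2 * growthConst D 3) * g H * τ ^ (2 - s) := by
      field_simp
    rw [e7]
    have : 0 ≤ 2 * growthConst D 3 * g H * τ ^ (2 - s) := by positivity
    nlinarith
  · rw [radialKernel_scaled_of_lt hR _ hzR]
    have hH3 : 3 * h / ‖z‖ ^ s ≤ 3 * H := by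
      rw [hH, Real.rpow_neg hR.le, ← mul_assoc, ← div_eq_mul_inv]
      gcongr
    have hgbd : ∀ c : ℝ, |c| ≤ 3 * h / ‖z‖ ^ s → g c ≤ growthConst D 3 * g H := fun c hc =>
      (hg.mono ((le_abs_self c).trans (hc.trans hH3))).trans
        (hg.apply_mul_le_growthConst 3 hH0.le)
    have h1 := hgbd a (abs_holderQuot_barrier_le h hh.le x z)
    have h2 : g (-b) ≤ growthConst D 3 * g H := by
      apply hgbd
      have := abs_holderQuot_barrier_le (s := s) (R := R) h hh.le x (-z)
      rw [norm_neg, ← hx] at this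
      rw [hb, neg_neg]; exact this
    rw [hg.odd] at h2
    have e8 : (6 * growthConst D 28 + 2 * growthConst D 3) * g H / (R ^ s * R ^ n) *
        (R ^ s * R ^ n / (‖z‖ ^ s * ‖z‖ ^ n)) =
        (6 * growthConst D 28 + 2 * growthConst D 3) * g H / (‖z‖ ^ s * ‖z‖ ^ n) := by
      field_simp
    rw [e8]
    gcongr
    have : 0 ≤ 6 * growthConst D 28 * g H := by positivity
    nlinarith

/-- The constant in the upper bound for the operator applied to the barrier: `28` is twice the
Lipschitz constant of the barrier profile (the slope of `g` on `[-m, m]` is estimated through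
`g (2 * m)`) and `3` bounds its height. -/
def barrierConst (n : ℕ) (D s : ℝ) : ℝ :=
  (6 * growthConst D 28 + 2 * growthConst D 3) * ∫ z : E n, radialKernel n (2 - 2 * s) s z

lemma barrierConst_nonneg (n : ℕ) (D s : ℝ) : 0 ≤ barrierConst n D s := by
  have hC28 := growthConst_pos D 28
  have hC3 := growthConst_pos D 3
  exact mul_nonneg (by positivity) (integral_nonneg fun z => radialKernel_nonneg _ _ _ z)

/-- The weak form of `(-Δ_g)^s v ≤ C R^(-s) g (h R^(-s))` for the barrier `v` of height `h`. -/
theorem integral_barrierKernel_le (hn : 1 ≤ n) (hg : IsDoublingDensity D g) (hs0 : 0 < s)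
    (hs1 : s < 1) (hR : 0 < R) {h : ℝ} (hh : 0 < h) {φ : E n → ℝ} (hφ : Integrable φ)
    (hφ0 : ∀ x, 0 ≤ φ x)
    (hint : Integrable (fun p : E n × E n => barrierKernel g s R h p * (φ p.1 - φ p.2))) :
    ∫ p : E n × E n, barrierKernel g s R h p * (φ p.1 - φ p.2) ≤
      barrierConst n D s * g (h * R ^ (-s)) / R ^ s * ∫ x, φ x := by
  have hgH : 0 ≤ g (h * R ^ (-s)) := hg.nonneg (by positivity)
  have hC28 := growthConst_pos D 28
  have hC3 := growthConst_pos D 3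
  have hker := integrable_radialKernel_scaled (α := 2 - 2 * s) (β := s) hn hR (by linarith) hs0
  refine (integral_antisymm_le (measurable_barrierKernel hg s R h) ?_ ?_ (hker.const_mul _) ?_
    (fun x z => barrierKernel_symm_le hg hs1 hs0 hR hh x z) hφ hφ0 hint).trans_eq ?_
  · intro x y
    simp only [barrierKernel, holderQuot]
    rw [norm_sub_rev y x, ← neg_sub (scaledBarrier R h x), neg_div, hg.odd, neg_div]
  · intro ε hε
    refine ⟨fun z => g (3 * h / ε ^ s) / (ε ^ s * ε ^ n) *
      radialKernel n (2 - 2 * s) s (ε⁻¹ • z),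
      (integrable_radialKernel_scaled hn hε (by linarith) hs0).const_mul _, ?_⟩
    intro x z hz
    have hz0 := hε.trans hz
    have e : x - (x + z) = -z := by abel
    beta_reduce
    rw [radialKernel_scaled_of_lt hε _ hz]
    simp only [barrierKernel, e, norm_neg]
    rw [abs_div, abs_of_pos (a := ‖z‖ ^ s * ‖z‖ ^ n) (by positivity), hg.abs_apply]
    have e8 : g (3 * h / ε ^ s) / (ε ^ s * ε ^ n) * (ε ^ s * ε ^ n / (‖z‖ ^ s * ‖z‖ ^ n)) =
        g (3 * h / ε ^ s) / (‖z‖ ^ s * ‖z‖ ^ n) := by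
      field_simp
    rw [e8]
    gcongr
    apply hg.mono
    refine (abs_holderQuot_barrier_le h hh.le x z).trans ?_
    gcongr
  · intro z
    have := radialKernel_nonneg n (2 - 2 * s) s (R⁻¹ • z)
    positivity
  · rw [integral_const_mul, integral_radialKernel_scaled hR, barrierConst]
    field_simp

end kernel

/-! ### Integrability -/

section measure

variable {n : ℕ} {s D : ℝ} {g : ℝ → ℝ}

/-- By the doubling property, `L^G` may be described by `t g(t)` in place of `G(t)`. -/
lemma memLG_iff (hg : IsDoublingDensity D g) {α : Type*} [MeasurableSpace α] {ν : Measure α}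
    {u : α → ℝ} : MemLG g ν u ↔
      AEStronglyMeasurable u ν ∧ Integrable (fun x => u x * g (u x)) ν := by
  unfold MemLG
  refine and_congr_right fun hu => ?_
  have hmeas : AEStronglyMeasurable (fun x => u x * g (u x)) ν :=
    hu.mul (hg.cont.comp_aestronglyMeasurable hu)
  rw [← lintegral_ofReal_ne_top_iff_integrable hmeas
    (Eventually.of_forall fun x => hg.mul_self_nonneg (u x)), lt_top_iff_ne_top]
  constructor
  · intro h
    refine ne_top_of_le_ne_top (ENNReal.mul_ne_top (ENNReal.ofReal_ne_top (r := |2 * D|)) h) ?_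
    rw [← lintegral_const_mul' _ _ ENNReal.ofReal_ne_top]
    refine lintegral_mono fun x => ?_
    rw [← ENNReal.ofReal_mul (abs_nonneg _)]
    refine ENNReal.ofReal_le_ofReal ((hg.mul_self_le_young (u x)).trans ?_)
    refine mul_le_mul_of_nonneg_right (le_abs_self _) ?_
    exact intervalIntegral.integral_nonneg (abs_nonneg _) fun t ht => hg.nonneg ht.1
  · intro h
    exact ne_top_of_le_ne_top h
      (lintegral_mono fun x => ENNReal.ofReal_le_ofReal (hg.young_le (u x)))

lemma measurable_density (n : ℕ) :
    Measurable fun p : E n × E n => ENNReal.ofReal (1 / ‖p.1 - p.2‖ ^ n) := by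
  fun_prop

lemma toReal_density_smul (p : E n × E n) (a : ℝ) :
    (ENNReal.ofReal (1 / ‖p.1 - p.2‖ ^ n)).toReal • a = a / ‖p.1 - p.2‖ ^ n := by
  rw [ENNReal.toReal_ofReal (by positivity), smul_eq_mul]; ring

lemma mu_absolutelyContinuous (n : ℕ) : mu n ≪ (volume : Measure (E n × E n)) :=
  withDensity_absolutelyContinuous _ _

lemma integrable_mu_iff {f : E n × E n → ℝ} :
    Integrable f (mu n) ↔ Integrable fun p => f p / ‖p.1 - p.2‖ ^ n := by
  rw [mu, integrable_withDensity_iff_integrable_smul' (measurable_density n)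
    (Eventually.of_forall fun p => ENNReal.ofReal_lt_top)]
  simp only [toReal_density_smul]

lemma integral_mu (f : E n × E n → ℝ) :
    ∫ p, f p ∂(mu n) = ∫ p, f p / ‖p.1 - p.2‖ ^ n := by
  rw [mu, integral_withDensity_eq_integral_toReal_smul (measurable_density n)
    (Eventually.of_forall fun p => ENNReal.ofReal_lt_top)]
  simp only [toReal_density_smul]

lemma ae_mu_of_ae {q : E n → Prop} (h : ∀ᵐ x ∂(volume : Measure (E n)), q x) :
    ∀ᵐ p ∂(mu n), q p.1 ∧ q p.2 := by
  refine (mu_absolutelyContinuous n).ae_le ?_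
  exact (Measure.quasiMeasurePreserving_fst.ae h).and (Measure.quasiMeasurePreserving_snd.ae h)

lemma aestronglyMeasurable_holderQuot {u : E n → ℝ} (hu : AEStronglyMeasurable u) :
    AEStronglyMeasurable (holderQuot s u) (mu n) := by
  refine AEStronglyMeasurable.mono_ac (mu_absolutelyContinuous n) ?_
  unfold holderQuot
  refine AEMeasurable.aestronglyMeasurable ?_
  exact ((hu.comp_fst (ν := volume)).aemeasurable.sub (hu.comp_snd (μ := volume)).aemeasurable).div
    ((measurable_fst.sub measurable_snd).norm.pow_const s).aemeasurable

lemma integrable_mul_comp_sub {φ ρ : E n → ℝ} (hφ : Integrable φ) (hρ : Integrable ρ) :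
    Integrable fun p : E n × E n => φ p.1 * ρ (p.2 - p.1) := by
  have hT : MeasurePreserving (fun p : E n × E n => (p.1, p.1 + p.2))
      (volume : Measure (E n × E n)) volume :=
    measurePreserving_prod_add (volume : Measure (E n)) (volume : Measure (E n))
  refine (hT.integrable_comp_emb (MeasurableEquiv.shearAddRight (E n)).measurableEmbedding).1 ?_
  refine (hφ.mul_prod hρ).congr (Eventually.of_forall fun p => ?_)
  simp [Function.comp]

lemma integrable_swap {f : E n × E n → ℝ} (hf : Integrable f) :
    Integrable fun p : E n × E n => f p.swap :=
  hf.swap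

lemma holderQuot_swap (u : E n → ℝ) (x y : E n) :
    holderQuot s u (y, x) = -holderQuot s u (x, y) := by
  simp only [holderQuot]
  rw [norm_sub_rev y x, ← neg_sub (u x), neg_div]

end measure

section barrier

variable {n : ℕ} {s R h D : ℝ} {g : ℝ → ℝ}

lemma scaledBarrier_eq_zero (hR : 0 < R) {x : E n} (hx : x ∉ Metric.ball (0 : E n) (R / 3)) :
    scaledBarrier R h x = 0 := by
  rw [scaledBarrier, barrier_eq_zero hR hx, mul_zero]

/-- Near the diagonal the modular density of the barrier is controlled by its Lipschitz bound, and
away from it by its maximum. -/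
lemma holderQuot_barrier_mul_le (hg : IsDoublingDensity D g) (hs0 : 0 < s) (hs1 : s < 1)
    (hR : 0 < R) (hh : 0 < h) (x z : E n) :
    holderQuot s (scaledBarrier R h) (x, x + z) * g (holderQuot s (scaledBarrier R h) (x, x + z)) /
      ‖z‖ ^ n ≤ 14 * (h * R ^ (-s)) * g (14 * (h * R ^ (-s))) / R ^ n *
        radialKernel n (1 - s) s (R⁻¹ • z) := by
  set H := h * R ^ (-s) with hH
  have hH0 : 0 < H := by positivity
  have hgH := hg.nonneg (t := 14 * H) (by positivity)
  rcases eq_or_ne z 0 with rfl | hz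
  · have := radialKernel_nonneg n (1 - s) s (R⁻¹ • (0 : E n))
    have e : holderQuot s (scaledBarrier R h) (x, x + (0 : E n)) = 0 := by simp [holderQuot]
    rw [e, zero_mul, zero_div]
    positivity
  have hz0 : 0 < ‖z‖ := norm_pos_iff.2 hz
  set a := holderQuot s (scaledBarrier R h) (x, x + z) with ha
  -- for `c = (|z|/R)^(1-s)` near the diagonal and `c = (R/|z|)^s` away from it
  have main : ∀ c : ℝ, 0 ≤ c → c ≤ 1 → |a| ≤ 14 * H * c →
      a * g a ≤ 14 * H * g (14 * H) * c := by
    intro c hc hc1 hac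
    rw [← hg.mul_self_abs a]
    have h1 : g |a| ≤ g (14 * H) := hg.mono (hac.trans (by nlinarith))
    calc |a| * g |a| ≤ (14 * H * c) * g (14 * H) :=
          mul_le_mul hac h1 (hg.nonneg (abs_nonneg _)) (by positivity)
      _ = _ := by ring
  rcases le_or_gt ‖z‖ R with hzR | hzR
  · rw [radialKernel_scaled_of_le hR _ hzR]
    have hτ0 : 0 < ‖z‖ / R := by positivity
    have := main ((‖z‖ / R) ^ (1 - s)) (by positivity)
      (Real.rpow_le_one hτ0.le ((div_le_one hR).2 hzR) (by linarith))
      (abs_holderQuot_barrier_le' hR hh.le x hz)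
    rw [Real.rpow_sub hτ0 (1 - s), Real.rpow_natCast, div_le_iff₀ (by positivity)]
    refine this.trans_eq ?_
    rw [div_pow]
    field_simp
  · have hrk : radialKernel n (1 - s) s (R⁻¹ • z) = (R ^ s * R ^ n) / (‖z‖ ^ s * ‖z‖ ^ n) :=
      radialKernel_scaled_of_lt hR _ hzR
    rw [hrk]
    have hRz : R ^ s ≤ ‖z‖ ^ s := by gcongr
    have := main (R ^ s / ‖z‖ ^ s) (by positivity) ((div_le_one (by positivity)).2 hRz) (by
      refine (abs_holderQuot_barrier_le h hh.le x z).trans ?_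
      rw [hH, Real.rpow_neg hR.le]
      have : 14 * (h * (R ^ s)⁻¹) * (R ^ s / ‖z‖ ^ s) = 14 * h / ‖z‖ ^ s := by field_simp
      rw [this]
      gcongr
      norm_num)
    rw [div_le_iff₀ (by positivity)]
    refine this.trans_eq ?_
    field_simp

lemma integrable_holderQuot_barrier (hn : 1 ≤ n) (hg : IsDoublingDensity D g) (hs0 : 0 < s)
    (hs1 : s < 1) (hR : 0 < R) (hh : 0 < h) :
    Integrable (fun p : E n × E n => holderQuot s (scaledBarrier R h) p *
      g (holderQuot s (scaledBarrier R h) p)) (mu n) := by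
  rw [integrable_mu_iff]
  set Q : E n × E n → ℝ := fun p => holderQuot s (scaledBarrier R h) p *
      g (holderQuot s (scaledBarrier R h) p) / ‖p.1 - p.2‖ ^ n with hQ
  have hQ0 : ∀ p, 0 ≤ Q p := fun p => div_nonneg (hg.mul_self_nonneg _) (by positivity)
  have hQm : Measurable Q := by
    have := measurable_holderQuot (s := s) (measurable_scaledBarrier (n := n) R h)
    exact (this.mul (hg.cont.measurable.comp this)).div
      ((measurable_fst.sub measurable_snd).norm.pow_const n)
  set Ω := Metric.ball (0 : E n) (R / 3) with hΩ
  have hind : Integrable (Ω.indicator (fun _ => (1 : ℝ))) :=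
    (integrable_indicator_iff measurableSet_ball).2
      (integrableOn_const measure_ball_lt_top.ne)
  set ρ : E n → ℝ := fun z => 14 * (h * R ^ (-s)) * g (14 * (h * R ^ (-s))) / R ^ n *
        radialKernel n (1 - s) s (R⁻¹ • z) with hρ
  have hρi : Integrable ρ :=
    (integrable_radialKernel_scaled hn hR (by linarith) hs0).const_mul _
  have hb := integrable_mul_comp_sub hind hρi
  have hQρ : ∀ x y, Q (x, y) ≤ ρ (y - x) := by
    intro x y
    have := holderQuot_barrier_mul_le hg hs0 hs1 hR hh x (y - x)
    rw [add_sub_cancel] at this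
    simp only [hQ, hρ]
    rwa [norm_sub_rev x y]
  have hQs : ∀ x y, Q (x, y) = Q (y, x) := by
    intro x y
    simp only [hQ]
    rw [holderQuot_swap _ y x, hg.odd, neg_mul_neg, norm_sub_rev]
  refine Integrable.mono' (hb.add (integrable_swap hb)) hQm.aestronglyMeasurable
    (Eventually.of_forall fun p => ?_)
  obtain ⟨x, y⟩ := p
  rw [Real.norm_of_nonneg (hQ0 _)]
  simp only [Pi.add_apply, Prod.swap]
  have h1 := (hQ0 (x, y)).trans (hQρ x y)
  have h2 := (hQ0 (y, x)).trans (hQρ y x)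
  by_cases hx : x ∈ Ω
  · rw [indicator_of_mem hx, one_mul]
    have : 0 ≤ Ω.indicator (fun _ => (1 : ℝ)) y := indicator_nonneg (fun _ _ => zero_le_one) _
    nlinarith [hQρ x y]
  · rw [indicator_of_notMem hx, zero_mul, zero_add]
    by_cases hy : y ∈ Ω
    · rw [indicator_of_mem hy, one_mul, hQs]; exact hQρ y x
    · rw [indicator_of_notMem hy, zero_mul]
      refine le_of_eq ?_
      simp only [hQ, holderQuot, scaledBarrier_eq_zero hR hx, scaledBarrier_eq_zero hR hy]
      simp

end barrier

/-! ### The test function -/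

section testFn

variable {n : ℕ} {s R h D : ℝ} {g : ℝ → ℝ} {u : E n → ℝ}

/-- The test function `(v - u)₊`, where `v` is the barrier of height `h`. -/
def testFn (R h : ℝ) (u : E n → ℝ) (x : E n) : ℝ := max (scaledBarrier R h x - u x) 0

lemma testFn_nonneg (x : E n) : 0 ≤ testFn R h u x := le_max_right _ _

lemma testFn_le (hh : 0 ≤ h) {x : E n} (hx : 0 ≤ u x) :
    testFn R h u x ≤ scaledBarrier R h x :=
  max_le (by linarith) (mul_nonneg hh (barrier_nonneg x))

lemma scaledBarrier_le (hh : 0 ≤ h) (x : E n) : scaledBarrier R h x ≤ 3 * h := by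
  rw [scaledBarrier, mul_comm]; exact mul_le_mul_of_nonneg_right (barrier_le x) hh

lemma testFn_eq_zero (hR : 0 < R) {x : E n} (hx : 0 ≤ u x)
    (hxΩ : x ∉ Metric.ball (0 : E n) (R / 3)) : testFn R h u x = 0 := by
  rw [testFn, scaledBarrier_eq_zero hR hxΩ]; exact max_eq_right (by linarith)

lemma aestronglyMeasurable_testFn (hu : AEStronglyMeasurable u) :
    AEStronglyMeasurable (testFn R h u) :=
  ((measurable_scaledBarrier R h).aestronglyMeasurable.sub hu).sup aestronglyMeasurable_const

lemma integrable_testFn (hR : 0 < R) (hh : 0 ≤ h) (hu : AEStronglyMeasurable u)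
    (hu0 : ∀ᵐ x ∂(volume : Measure (E n)), 0 ≤ u x) : Integrable (testFn R h u) := by
  have hind : Integrable ((Metric.ball (0 : E n) (R / 3)).indicator (fun _ => 3 * h)) :=
    (integrable_indicator_iff measurableSet_ball).2
      (integrableOn_const measure_ball_lt_top.ne)
  refine Integrable.mono' hind (aestronglyMeasurable_testFn hu) ?_
  filter_upwards [hu0] with x hx
  rw [Real.norm_of_nonneg (testFn_nonneg x)]
  by_cases hxΩ : x ∈ Metric.ball (0 : E n) (R / 3)
  · rw [indicator_of_mem hxΩ]; exact (testFn_le hh hx).trans (scaledBarrier_le hh x)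
  · rw [indicator_of_notMem hxΩ, testFn_eq_zero hR hx hxΩ]

lemma abs_testFn_sub_le (x y : E n) : |testFn R h u x - testFn R h u y| ≤
    |(scaledBarrier R h x - u x) - (scaledBarrier R h y - u y)| := by
  have := abs_max_sub_max_le_max (scaledBarrier R h x - u x) 0 (scaledBarrier R h y - u y) 0
  simpa [testFn] using this

lemma abs_holderQuot_testFn_le (p : E n × E n) : |holderQuot s (testFn R h u) p| ≤
    |holderQuot s (scaledBarrier R h) p + -holderQuot s u p| := by
  have e : holderQuot s (scaledBarrier R h) p + -holderQuot s u p =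
      ((scaledBarrier R h p.1 - u p.1) - (scaledBarrier R h p.2 - u p.2)) / ‖p.1 - p.2‖ ^ s := by
    unfold holderQuot; ring
  rw [e, holderQuot, abs_div, abs_div]
  exact div_le_div_of_nonneg_right (abs_testFn_sub_le _ _) (abs_nonneg _)

lemma abs_holderQuot_testFn_le_of_notMem (hR : 0 < R) (hh : 0 ≤ h) {x y : E n} (hx : 0 ≤ u x)
    (hy : 0 ≤ u y) (hyΩ : y ∉ Metric.ball (0 : E n) (R / 3)) :
    |holderQuot s (testFn R h u) (x, y)| ≤ |holderQuot s (scaledBarrier R h) (x, y)| := by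
  simp only [holderQuot, testFn_eq_zero hR hy hyΩ, scaledBarrier_eq_zero hR hyΩ, sub_zero]
  rw [abs_div, abs_div]
  refine div_le_div_of_nonneg_right ?_ (abs_nonneg _)
  rw [abs_of_nonneg (testFn_nonneg x), abs_of_nonneg (a := scaledBarrier R h x)
    (mul_nonneg hh (barrier_nonneg x))]
  exact testFn_le hh hx

/-- Monotonicity of the operator along the direction `(v - u)₊`. -/
lemma apply_sub_mul_testFn_nonneg (hg : IsDoublingDensity D g) (p : E n × E n) :
    0 ≤ (g (holderQuot s (scaledBarrier R h) p) - g (holderQuot s u p)) *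
      holderQuot s (testFn R h u) p := by
  have hr : 0 ≤ ‖p.1 - p.2‖ ^ s := by positivity
  rcases le_total (scaledBarrier R h p.1 - u p.1) (scaledBarrier R h p.2 - u p.2) with hle | hle
  · refine mul_nonneg_of_nonpos_of_nonpos ?_ ?_
    · rw [sub_nonpos]
      exact hg.mono (div_le_div_of_nonneg_right (by linarith) hr)
    · refine div_nonpos_of_nonpos_of_nonneg ?_ hr
      rw [sub_nonpos]; exact max_le_max_right 0 hle
  · refine mul_nonneg ?_ ?_
    · rw [sub_nonneg]
      exact hg.mono (div_le_div_of_nonneg_right (by linarith) hr)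
    · refine div_nonneg ?_ hr
      rw [sub_nonneg]; exact max_le_max_right 0 hle

/-- The test function has finite modular: on `U × U` it is a truncation of `v - u`, and for pairs with
a point outside the ball its quotients are dominated by those of the barrier, because
`0 ≤ (v - u)₊ ≤ v`. -/
lemma integrable_holderQuot_testFn (hn : 1 ≤ n) (hg : IsDoublingDensity D g) (hs0 : 0 < s)
    (hs1 : s < 1) (hR : 0 < R) (hh : 0 < h) (hu : AEStronglyMeasurable u)
    (hu0 : ∀ᵐ x ∂(volume : Measure (E n)), 0 ≤ u x) {U : Set (E n)} (hU : MeasurableSet U)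
    (hΩU : Metric.ball (0 : E n) (R / 3) ⊆ U)
    (hDu : Integrable (fun p => holderQuot s u p * g (holderQuot s u p))
      ((mu n).restrict (U ×ˢ U))) :
    Integrable (fun p => holderQuot s (testFn R h u) p * g (holderQuot s (testFn R h u) p))
      (mu n) := by
  have hφm := aestronglyMeasurable_holderQuot (s := s)
    (aestronglyMeasurable_testFn (R := R) (h := h) hu)
  have hDv := integrable_holderQuot_barrier hn hg hs0 hs1 hR hh (n := n)
  have hDu' := (integrable_indicator_iff (hU.prod hU)).2 hDu
  refine Integrable.mono' (((hDv.add hDu').const_mul (|2 * D|)).add hDv)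
    (hφm.mul (hg.cont.comp_aestronglyMeasurable hφm)) ?_
  filter_upwards [ae_mu_of_ae hu0] with p hp
  obtain ⟨x, y⟩ := p
  obtain ⟨hx, hy⟩ := hp
  rw [Real.norm_of_nonneg (hg.mul_self_nonneg _)]
  simp only [Pi.add_apply]
  have hv0 := hg.mul_self_nonneg (holderQuot s (scaledBarrier R h) (x, y))
  have hu0' := hg.mul_self_nonneg (holderQuot s u (x, y))
  have hind : 0 ≤ (U ×ˢ U).indicator (fun p => holderQuot s u p * g (holderQuot s u p)) (x, y) :=
    indicator_nonneg (fun p _ => hg.mul_self_nonneg _) _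
  by_cases hmem : (x, y) ∈ U ×ˢ U
  · rw [indicator_of_mem hmem]
    have h1 := hg.mul_self_mono (abs_holderQuot_testFn_le (s := s) (R := R) (h := h) (u := u) (x, y))
    have h2 := hg.mul_self_add_le (holderQuot s (scaledBarrier R h) (x, y))
      (-holderQuot s u (x, y))
    rw [hg.odd (holderQuot s u (x, y)), neg_mul_neg] at h2
    have h3 := mul_le_mul_of_nonneg_right (le_abs_self (2 * D)) (add_nonneg hv0 hu0')
    linarith
  · have h3 := mul_nonneg (abs_nonneg (2 * D)) (add_nonneg hv0 hind)
    suffices holderQuot s (testFn R h u) (x, y) * g (holderQuot s (testFn R h u) (x, y)) ≤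
        holderQuot s (scaledBarrier R h) (x, y) * g (holderQuot s (scaledBarrier R h) (x, y)) by
      linarith
    apply hg.mul_self_mono
    by_cases hyU : y ∈ Metric.ball (0 : E n) (R / 3)
    · have hxU : x ∉ Metric.ball (0 : E n) (R / 3) := fun hx' => hmem ⟨hΩU hx', hΩU hyU⟩
      have := abs_holderQuot_testFn_le_of_notMem (s := s) (h := h) hR hh.le hy hx hxU
      rwa [holderQuot_swap _ x y, holderQuot_swap _ x y, abs_neg, abs_neg] at this
    · exact abs_holderQuot_testFn_le_of_notMem hR hh.le hx hy hyU

lemma memW₀_testFn (hn : 1 ≤ n) (hg : IsDoublingDensity D g) (hs0 : 0 < s)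
    (hs1 : s < 1) (hR : 0 < R) (hh : 0 < h) (hu : AEStronglyMeasurable u)
    (hu0 : ∀ᵐ x ∂(volume : Measure (E n)), 0 ≤ u x) {U : Set (E n)} (hU : MeasurableSet U)
    (hΩU : Metric.ball (0 : E n) (R / 3) ⊆ U)
    (hDu : Integrable (fun p => holderQuot s u p * g (holderQuot s u p))
      ((mu n).restrict (U ×ˢ U))) :
    MemW₀ g s (Metric.ball (0 : E n) (R / 3)) (testFn R h u) := by
  have hφm := aestronglyMeasurable_testFn (R := R) (h := h) hu
  refine ⟨⟨?_, ?_⟩, ?_⟩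
  · rw [memLG_iff hg, Measure.restrict_univ]
    refine ⟨hφm, ?_⟩
    refine Integrable.mono' ((integrable_testFn hR hh.le hu hu0).mul_const (g (3 * h)))
      (hφm.mul (hg.cont.comp_aestronglyMeasurable hφm)) ?_
    filter_upwards [hu0] with x hx
    rw [Real.norm_of_nonneg (hg.mul_self_nonneg _)]
    exact mul_le_mul_of_nonneg_left
      (hg.mono ((testFn_le hh.le hx).trans (scaledBarrier_le hh.le x))) (testFn_nonneg x)
  · rw [memLG_iff hg, univ_prod_univ, Measure.restrict_univ]
    exact ⟨aestronglyMeasurable_holderQuot hφm,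
      integrable_holderQuot_testFn hn hg hs0 hs1 hR hh hu hu0 hU hΩU hDu⟩
  · filter_upwards [hu0] with x hx hxΩ using testFn_eq_zero hR hx hxΩ

end testFn

/-! ### Testing the supersolution -/

section testing

variable {n : ℕ} {s R h D : ℝ} {g : ℝ → ℝ} {u : E n → ℝ}

/-- The form of the barrier against a function of finite modular converges, by Young's inequality. -/
lemma integrable_barrier_form (hn : 1 ≤ n) (hg : IsDoublingDensity D g) (hs0 : 0 < s)
    (hs1 : s < 1) (hR : 0 < R) (hh : 0 < h) {φ : E n → ℝ} (hφm : AEStronglyMeasurable φ)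
    (hφ : Integrable (fun p => holderQuot s φ p * g (holderQuot s φ p)) (mu n)) :
    Integrable (fun p => g (holderQuot s (scaledBarrier R h) p) * holderQuot s φ p) (mu n) := by
  have hv := measurable_holderQuot (s := s) (measurable_scaledBarrier (n := n) R h)
  exact Integrable.mono' ((integrable_holderQuot_barrier hn hg hs0 hs1 hR hh).add hφ)
    ((hg.cont.measurable.comp hv).aestronglyMeasurable.mul (aestronglyMeasurable_holderQuot hφm))
    (Eventually.of_forall fun p => hg.abs_apply_mul_le _ _)

/-- The density of the nonlocal tail of `u`. -/
def tailDensity (g : ℝ → ℝ) (s : ℝ) (u : E n → ℝ) (y : E n) : ℝ :=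
  g (|u y| / (1 + ‖y‖) ^ s) / (1 + ‖y‖) ^ ((n : ℝ) + s)

lemma tailDensity_nonneg (hg : IsDoublingDensity D g) (y : E n) : 0 ≤ tailDensity g s u y :=
  div_nonneg (hg.nonneg (by positivity)) (by positivity)

lemma integrable_tailDensity (hg : IsDoublingDensity D g) (hu : AEStronglyMeasurable u)
    (htail : ∫⁻ x : E n, ENNReal.ofReal
      (g (|u x| / (1 + ‖x‖) ^ s) / (1 + ‖x‖) ^ ((n : ℝ) + s)) < ⊤) :
    Integrable (tailDensity g s u) := by
  refine (lintegral_ofReal_ne_top_iff_integrable ?_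
    (Eventually.of_forall fun y => tailDensity_nonneg hg y)).1 htail.ne
  have hm : Measurable fun y : E n => 1 + ‖y‖ := measurable_norm.const_add 1
  refine AEMeasurable.aestronglyMeasurable ?_
  refine AEMeasurable.div (hg.cont.measurable.comp_aemeasurable ?_)
    (hm.pow_const _).aemeasurable
  exact (measurable_norm.comp_aemeasurable hu.aemeasurable).div (hm.pow_const _).aemeasurable

/-- Far from the support of the test function the form of `u` is bounded below by the tail. -/
lemma neg_form_le_tail (hg : IsDoublingDensity D g) (hs0 : 0 < s) (hR : 0 < R) (hh : 0 ≤ h)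
    {δ : ℝ} (hδ : 0 < δ) {x y : E n} (hx : 0 ≤ u x) (hy : 0 ≤ u y)
    (hyΩ : y ∉ Metric.ball (0 : E n) (R / 3)) (hxy : δ * (1 + ‖y‖) ≤ ‖x - y‖) :
    -(g (holderQuot s u (x, y)) * holderQuot s (testFn R h u) (x, y)) ≤
      growthConst D ((δ ^ s)⁻¹) * (3 * h) / (δ ^ s * δ ^ n) * tailDensity g s u y *
        ‖x - y‖ ^ n := by
  have hy1 : 0 < 1 + ‖y‖ := by positivity
  set r := ‖x - y‖ with hr
  have hr0 : 0 < r := lt_of_lt_of_le (by positivity) hxy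
  have hrs : (δ * (1 + ‖y‖)) ^ s ≤ r ^ s := Real.rpow_le_rpow (by positivity) hxy hs0.le
  rw [Real.mul_rpow hδ.le hy1.le] at hrs
  have hrn : (δ * (1 + ‖y‖)) ^ n ≤ r ^ n := pow_le_pow_left₀ (by positivity) hxy n
  rw [mul_pow] at hrn
  have hC := growthConst_pos D ((δ ^ s)⁻¹)
  set t := |u y| / (1 + ‖y‖) ^ s with ht
  have ht0 : 0 ≤ t := by positivity
  have hgt := hg.nonneg ht0
  have h1 : -g (holderQuot s u (x, y)) ≤ growthConst D ((δ ^ s)⁻¹) * g t := by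
    rw [← hg.odd]
    refine (hg.mono ?_).trans (hg.apply_mul_le_growthConst ((δ ^ s)⁻¹) ht0)
    have e : (δ ^ s)⁻¹ * t = u y / (δ ^ s * (1 + ‖y‖) ^ s) := by
      rw [ht, abs_of_nonneg hy]; field_simp
    rw [e]
    calc -holderQuot s u (x, y) = (u y - u x) / r ^ s := by
          simp only [holderQuot, ← hr]; ring
      _ ≤ u y / (δ ^ s * (1 + ‖y‖) ^ s) :=
          div_le_div₀ hy (by linarith) (by positivity) hrs
  have h2 : holderQuot s (testFn R h u) (x, y) = testFn R h u x / r ^ s := by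
    simp only [holderQuot, testFn_eq_zero hR hy hyΩ, sub_zero, ← hr]
  have h3 : testFn R h u x ≤ 3 * h := (testFn_le hh hx).trans (scaledBarrier_le hh x)
  have h0 := testFn_nonneg (R := R) (h := h) (u := u) x
  rw [h2, ← neg_mul]
  have htail : tailDensity g s u y = g t / ((1 + ‖y‖) ^ n * (1 + ‖y‖) ^ s) := by
    rw [tailDensity, Real.rpow_add hy1, Real.rpow_natCast]
  rw [htail]
  calc -g (holderQuot s u (x, y)) * (testFn R h u x / r ^ s)
      ≤ growthConst D ((δ ^ s)⁻¹) * g t * (3 * h / r ^ s) := by gcongr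
    _ = growthConst D ((δ ^ s)⁻¹) * g t * (3 * h) * r ^ n / (r ^ s * r ^ n) := by
        field_simp
    _ ≤ growthConst D ((δ ^ s)⁻¹) * g t * (3 * h) * r ^ n /
        ((δ ^ s * (1 + ‖y‖) ^ s) * (δ ^ n * (1 + ‖y‖) ^ n)) := by gcongr
    _ = _ := by field_simp

/-- Points outside `U` have distance at least `δ (1 + |y|)` from the ball, near and far alike. -/
lemma exists_dist_lower_bound (hR : 0 < R) {U : Set (E n)} (hU : IsOpen U)
    (hcpt : IsCompact (closure (Metric.ball (0 : E n) (R / 3))))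
    (hΩU : closure (Metric.ball (0 : E n) (R / 3)) ⊆ U) :
    ∃ δ : ℝ, 0 < δ ∧ ∀ x ∈ Metric.ball (0 : E n) (R / 3), ∀ y ∉ U,
      δ * (1 + ‖y‖) ≤ ‖x - y‖ := by
  obtain ⟨ε, hε, hεU⟩ := hcpt.exists_thickening_subset_open hU hΩU
  refine ⟨ε / (ε + (1 + R)), by positivity, fun x hx y hy => ?_⟩
  have h1 : ε ≤ ‖x - y‖ := by
    by_contra! hlt
    refine hy (hεU (Metric.mem_thickening_iff.2 ⟨x, subset_closure hx, ?_⟩))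
    rwa [dist_comm, dist_eq_norm]
  have hx' : ‖x‖ < R / 3 := mem_ball_zero_iff.1 hx
  have h2 : ‖y‖ ≤ ‖x‖ + ‖x - y‖ := by
    have := norm_sub_le x (x - y)
    rwa [sub_sub_cancel] at this
  rw [div_mul_eq_mul_div, div_le_iff₀ (by positivity)]
  nlinarith

/-- The form of `u` converges: near the diagonal by Young's inequality, and for pairs with one point
outside `U` because it lies between the form of the barrier and the integrable tail of `u`. -/
lemma integrable_form (hn : 1 ≤ n) (hg : IsDoublingDensity D g) (hs0 : 0 < s)
    (hs1 : s < 1) (hR : 0 < R) (hh : 0 < h) (hu : AEStronglyMeasurable u)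
    (hu0 : ∀ᵐ x ∂(volume : Measure (E n)), 0 ≤ u x) {U : Set (E n)} (hU : IsOpen U)
    (hcpt : IsCompact (closure (Metric.ball (0 : E n) (R / 3))))
    (hΩU : closure (Metric.ball (0 : E n) (R / 3)) ⊆ U)
    (hDu : Integrable (fun p => holderQuot s u p * g (holderQuot s u p))
      ((mu n).restrict (U ×ˢ U)))
    (htail : Integrable (tailDensity g s u)) :
    Integrable (fun p => g (holderQuot s u p) * holderQuot s (testFn R h u) p) (mu n) := by
  obtain ⟨δ, hδ, hdist⟩ := exists_dist_lower_bound hR hU hcpt hΩU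
  have hΩU' := subset_closure.trans hΩU
  have hφm := aestronglyMeasurable_testFn (R := R) (h := h) hu
  have hDφm := aestronglyMeasurable_holderQuot (s := s) hφm
  have hDφ := integrable_holderQuot_testFn hn hg hs0 hs1 hR hh hu hu0 hU.measurableSet hΩU' hDu
  have hT1 := integrable_barrier_form hn hg hs0 hs1 hR hh hφm hDφ
  have hDu' := (integrable_indicator_iff (hU.measurableSet.prod hU.measurableSet)).2 hDu
  set Ω := Metric.ball (0 : E n) (R / 3) with hΩ
  set C := growthConst D ((δ ^ s)⁻¹) * (3 * h) / (δ ^ s * δ ^ n) with hC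
  have hC0 : 0 ≤ C := by
    have := growthConst_pos D ((δ ^ s)⁻¹)
    positivity
  have hind : Integrable (Ω.indicator (fun _ => C)) :=
    (integrable_indicator_iff measurableSet_ball).2
      (integrableOn_const measure_ball_lt_top.ne)
  set q : E n × E n → ℝ := fun p => Ω.indicator (fun _ => C) p.1 * tailDensity g s u p.2 with hq
  have hqi : Integrable q := hind.mul_prod htail
  have hq0 : ∀ p, 0 ≤ q p := fun p =>
    mul_nonneg (indicator_nonneg (fun _ _ => hC0) _) (tailDensity_nonneg hg _)
  have hQ : Integrable (fun p : E n × E n => (q p + q p.swap) * ‖p.1 - p.2‖ ^ n) (mu n) := by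
    rw [integrable_mu_iff]
    have hsum := hqi.add (integrable_swap hqi)
    have hrm : Measurable fun p : E n × E n => ‖p.1 - p.2‖ ^ n :=
      (measurable_fst.sub measurable_snd).norm.pow_const n
    refine Integrable.mono' hsum ((hsum.aemeasurable.mul hrm.aemeasurable).div
      hrm.aemeasurable).aestronglyMeasurable (Eventually.of_forall fun p => ?_)
    have h0 : 0 ≤ q p + q p.swap := add_nonneg (hq0 _) (hq0 _)
    rw [Real.norm_of_nonneg (by positivity), mul_div_assoc]
    exact mul_le_of_le_one_right h0 (div_self_le_one _)
  refine Integrable.mono' ((hDu'.add hDφ).add (hT1.norm.add hQ))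
    ((hg.cont.comp_aestronglyMeasurable (aestronglyMeasurable_holderQuot hu)).mul hDφm) ?_
  filter_upwards [ae_mu_of_ae hu0] with p hp
  obtain ⟨x, y⟩ := p
  obtain ⟨hx, hy⟩ := hp
  simp only [Pi.add_apply, Real.norm_eq_abs, Prod.swap]
  have hA : 0 ≤ (U ×ˢ U).indicator (fun p => holderQuot s u p * g (holderQuot s u p)) (x, y) :=
    indicator_nonneg (fun p _ => hg.mul_self_nonneg _) _
  have hB := hg.mul_self_nonneg (holderQuot s (testFn R h u) (x, y))
  have hB1 := abs_nonneg (g (holderQuot s (scaledBarrier R h) (x, y)) *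
    holderQuot s (testFn R h u) (x, y))
  have hQ0 : 0 ≤ (q (x, y) + q (y, x)) * ‖x - y‖ ^ n :=
    mul_nonneg (add_nonneg (hq0 _) (hq0 _)) (by positivity)
  by_cases hmem : (x, y) ∈ U ×ˢ U
  · rw [indicator_of_mem hmem]
    have := hg.abs_apply_mul_le (holderQuot s u (x, y)) (holderQuot s (testFn R h u) (x, y))
    linarith
  -- by monotonicity the integrand of `u` never exceeds that of the barrier
  have hup : g (holderQuot s u (x, y)) * holderQuot s (testFn R h u) (x, y) ≤
      |g (holderQuot s (scaledBarrier R h) (x, y)) * holderQuot s (testFn R h u) (x, y)| := by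
    have h1 := apply_sub_mul_testFn_nonneg (s := s) (R := R) (h := h) (u := u) hg (x, y)
    rw [sub_mul] at h1
    exact (sub_nonneg.1 h1).trans (le_abs_self _)
  suffices -(g (holderQuot s u (x, y)) * holderQuot s (testFn R h u) (x, y)) ≤
      (q (x, y) + q (y, x)) * ‖x - y‖ ^ n by
    rw [abs_le']
    constructor <;> linarith
  by_cases hxΩ : x ∈ Ω
  · have hyU : y ∉ U := fun h' => hmem ⟨hΩU' hxΩ, h'⟩
    have h1 := neg_form_le_tail (h := h) hg hs0 hR hh.le hδ hx hy (fun h' => hyU (hΩU' h'))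
      (hdist x hxΩ y hyU)
    have h2 : q (x, y) = C * tailDensity g s u y := by
      simp only [hq]; rw [indicator_of_mem hxΩ]
    have h3 := mul_nonneg (hq0 (y, x)) (pow_nonneg (norm_nonneg (x - y)) n)
    rw [add_mul, h2]
    linarith
  · by_cases hyΩ : y ∈ Ω
    · have hxU : x ∉ U := fun h' => hmem ⟨h', hΩU' hyΩ⟩
      have h1 := neg_form_le_tail (h := h) hg hs0 hR hh.le hδ hy hx hxΩ (hdist y hyΩ x hxU)
      rw [holderQuot_swap _ x y, holderQuot_swap _ x y, hg.odd, neg_mul_neg, norm_sub_rev] at h1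
      have h2 : q (y, x) = C * tailDensity g s u x := by
        simp only [hq]; rw [indicator_of_mem hyΩ]
      have h3 := mul_nonneg (hq0 (x, y)) (pow_nonneg (norm_nonneg (x - y)) n)
      rw [add_mul, h2]
      linarith
    · have : holderQuot s (testFn R h u) (x, y) = 0 := by
        simp only [holderQuot, testFn_eq_zero hR hx hxΩ, testFn_eq_zero hR hy hyΩ]
        simp
      rw [this, mul_zero, neg_zero]
      exact hQ0

/-- The gain from the values of `u` in the annulus: for `x` in the inner ball and `y` in the
annulus the increment of `g` is at least a multiple of `g (R^(-s) u(y))`. The constant comes from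
`|x - y| ≤ 2 R`. -/
lemma annulus_gain (hg : IsDoublingDensity D g) (hs0 : 0 < s) (hs1 : s < 1) (hR : 0 < R)
    {x y : E n} (hy : 0 ≤ u y) (hxΩ : x ∈ Metric.ball (0 : E n) (R / 3))
    (hyA : y ∈ Metric.ball (0 : E n) R \ Metric.ball 0 (R / 2)) :
    testFn R h u x * g (R ^ (-s) * |u y|) / (growthConst D 4 * 2 ^ (n + 1) * (R ^ s * R ^ n)) ≤
      (g (holderQuot s (scaledBarrier R h) (x, y)) - g (holderQuot s u (x, y))) *
      holderQuot s (testFn R h u) (x, y) / ‖x - y‖ ^ n := by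
  have hx' : ‖x‖ < R / 3 := mem_ball_zero_iff.1 hxΩ
  have hy1 : ‖y‖ < R := mem_ball_zero_iff.1 hyA.1
  have hy2 : R / 2 ≤ ‖y‖ := by
    have := hyA.2
    rwa [mem_ball_zero_iff, not_lt] at this
  have hyΩ : y ∉ Metric.ball (0 : E n) (R / 3) := by
    rw [mem_ball_zero_iff, not_lt]; linarith
  set r := ‖x - y‖ with hr
  have hr0 : 0 < r := by
    refine norm_pos_iff.2 (sub_ne_zero.2 ?_)
    rintro rfl
    linarith
  have hr2 : r ≤ 2 * R := (norm_sub_le x y).trans (by linarith)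
  have hrs : r ^ s ≤ 2 * R ^ s := by
    calc r ^ s ≤ (2 * R) ^ s := Real.rpow_le_rpow hr0.le hr2 hs0.le
      _ = 2 ^ s * R ^ s := Real.mul_rpow zero_le_two hR.le
      _ ≤ 2 * R ^ s := by
          gcongr
          calc (2 : ℝ) ^ s ≤ 2 ^ (1 : ℝ) := Real.rpow_le_rpow_of_exponent_le one_le_two hs1.le
            _ = 2 := Real.rpow_one 2
  have hrn : r ^ n ≤ 2 ^ n * R ^ n := by
    rw [← mul_pow]; exact pow_le_pow_left₀ hr0.le hr2 n
  have hφ : holderQuot s (testFn R h u) (x, y) = testFn R h u x / r ^ s := by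
    simp only [holderQuot, testFn_eq_zero hR hy hyΩ, sub_zero, ← hr]
  have hφ0 := testFn_nonneg (R := R) (h := h) (u := u) x
  have hC := growthConst_pos D 4
  rcases eq_or_lt_of_le hφ0 with h0 | hpos
  · rw [hφ, ← h0]; simp
  have hlt : u x < scaledBarrier R h x := by
    rcases lt_max_iff.1 hpos with h1 | h1
    · linarith
    · exact absurd h1 (lt_irrefl _)
  set a := holderQuot s (scaledBarrier R h) (x, y) with ha
  set b := holderQuot s u (x, y) with hb
  have hab : u y / r ^ s ≤ a - b := by
    have e : a - b = (scaledBarrier R h x - u x + u y) / r ^ s := by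
      rw [ha, hb]; simp only [holderQuot, scaledBarrier_eq_zero hR hyΩ, ← hr]; ring
    rw [e]
    exact div_le_div_of_nonneg_right (by linarith) (by positivity)
  have hb0 : 0 ≤ u y / r ^ s := by positivity
  have hgain : g (R ^ (-s) * |u y|) / growthConst D 4 ≤ g a - g b := by
    refine le_trans ?_ (hg.apply_half_sub_le (by linarith))
    rw [div_le_iff₀' hC]
    refine le_trans (hg.mono ?_) (hg.apply_mul_le_growthConst 4 (by linarith))
    have : R ^ (-s) * |u y| ≤ 2 * (u y / r ^ s) := by
      rw [abs_of_nonneg hy, Real.rpow_neg hR.le, ← mul_div_assoc, le_div_iff₀ (by positivity)]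
      calc (R ^ s)⁻¹ * u y * r ^ s ≤ (R ^ s)⁻¹ * u y * (2 * R ^ s) := by gcongr
        _ = 2 * u y := by field_simp
    linarith
  have hg0 : 0 ≤ g (R ^ (-s) * |u y|) := hg.nonneg (by positivity)
  rw [hφ]
  calc testFn R h u x * g (R ^ (-s) * |u y|) /
        (growthConst D 4 * 2 ^ (n + 1) * (R ^ s * R ^ n))
      = (g (R ^ (-s) * |u y|) / growthConst D 4) * testFn R h u x /
          ((2 * R ^ s) * (2 ^ n * R ^ n)) := by rw [pow_succ]; field_simp
    _ ≤ (g a - g b) * testFn R h u x / (r ^ s * r ^ n) := by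
        refine div_le_div₀ (mul_nonneg ((by positivity : (0 : ℝ) ≤ _).trans hgain) hφ0) ?_
          (by positivity) ?_ <;> gcongr
    _ = _ := by field_simp

/-- The result of testing with `(v - u)₊`. The difference of the forms of `v` and `u` is bounded above
by the barrier estimate and the supersolution property. It is nonnegative pointwise, and its part
over pairs of a point of the ball and a point of the annulus bounds it below. -/
theorem integral_annulus_le (hn : 1 ≤ n) (hg : IsDoublingDensity D g) (hs0 : 0 < s)
    (hs1 : s < 1) (hR : 0 < R) (hh : 0 < h) {K : ℝ} (hK : 0 ≤ K)
    (huW : MemWTilde g s (Metric.ball (0 : E n) (R / 3)) u)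
    (hsup : IsWeakSupersolution g s (Metric.ball (0 : E n) (R / 3)) (fun _ => -K) u)
    (hu : AEStronglyMeasurable u)
    (hu0 : ∀ᵐ x ∂(volume : Measure (E n)), 0 ≤ u x)
    (hA : IntegrableOn (fun x => g (R ^ (-s) * |u x|))
      (Metric.ball (0 : E n) R \ Metric.ball 0 (R / 2))) :
    (∫ x, testFn R h u x) * (∫ x in Metric.ball (0 : E n) R \ Metric.ball 0 (R / 2),
      g (R ^ (-s) * |u x|)) / (growthConst D 4 * 2 ^ (n + 1) * (R ^ s * R ^ n)) ≤
    (barrierConst n D s * g (h * R ^ (-s)) / R ^ s + K) * ∫ x, testFn R h u x := by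
  obtain ⟨-, ⟨U, hU, hcpt, hΩU, hUW⟩, htail⟩ := huW
  have hDu := ((memLG_iff hg).1 hUW.2).2
  have hΩU' := subset_closure.trans hΩU
  have htail' := integrable_tailDensity hg hu htail
  have hφm := aestronglyMeasurable_testFn (R := R) (h := h) hu
  have hφi := integrable_testFn hR hh.le hu hu0
  have hDφ := integrable_holderQuot_testFn hn hg hs0 hs1 hR hh hu hu0 hU.measurableSet hΩU' hDu
  have hT1 := integrable_barrier_form hn hg hs0 hs1 hR hh hφm hDφ
  have hT2 := integrable_form hn hg hs0 hs1 hR hh hu hu0 hU hcpt hΩU hDu htail'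
  have hW0 := memW₀_testFn hn hg hs0 hs1 hR hh hu hu0 hU.measurableSet hΩU' hDu
  -- the supersolution inequality
  have hweak : -∫ p, g (holderQuot s u p) * holderQuot s (testFn R h u) p ∂(mu n) ≤
      K * ∫ x, testFn R h u x := by
    have h1 := hsup.2 _ hW0 (Eventually.of_forall fun x => testFn_nonneg x)
    have e : ∀ p : E n × E n, g (holderQuot s (fun x => -u x) p) * holderQuot s (testFn R h u) p =
        -(g (holderQuot s u p) * holderQuot s (testFn R h u) p) := by
      intro p
      have : holderQuot s (fun x => -u x) p = -holderQuot s u p := by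
        simp only [holderQuot]; ring
      rw [this, hg.odd, neg_mul]
    simp only [e, integral_neg, neg_neg, integral_const_mul] at h1
    refine h1.trans (mul_le_mul_of_nonneg_left ?_ hK)
    exact setIntegral_le_integral hφi (Eventually.of_forall fun x => testFn_nonneg x)
  -- the barrier inequality
  have hbar : ∫ p, g (holderQuot s (scaledBarrier R h) p) * holderQuot s (testFn R h u) p ∂(mu n) ≤
      barrierConst n D s * g (h * R ^ (-s)) / R ^ s * ∫ x, testFn R h u x := by
    have e : ∀ p : E n × E n, g (holderQuot s (scaledBarrier R h) p) *
        holderQuot s (testFn R h u) p / ‖p.1 - p.2‖ ^ n =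
        barrierKernel g s R h p * (testFn R h u p.1 - testFn R h u p.2) := by
      intro p
      simp only [barrierKernel]
      have e' : holderQuot s (testFn R h u) p =
        (testFn R h u p.1 - testFn R h u p.2) / ‖p.1 - p.2‖ ^ s := rfl
      rw [e', mul_div_assoc', div_div]
      ring
    rw [integrable_mu_iff] at hT1
    rw [integral_mu]
    simp only [e] at hT1 ⊢
    exact integral_barrierKernel_le hn hg hs0 hs1 hR hh hφi (fun x => testFn_nonneg x) hT1
  -- the gain from the annulus
  have hgain : (∫ x, testFn R h u x) * (∫ x in Metric.ball (0 : E n) R \ Metric.ball 0 (R / 2),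
      g (R ^ (-s) * |u x|)) / (growthConst D 4 * 2 ^ (n + 1) * (R ^ s * R ^ n)) ≤
      ∫ p, (g (holderQuot s (scaledBarrier R h) p) * holderQuot s (testFn R h u) p -
        g (holderQuot s u p) * holderQuot s (testFn R h u) p) ∂(mu n) := by
    have hAm : MeasurableSet (Metric.ball (0 : E n) R \ Metric.ball 0 (R / 2)) :=
      measurableSet_ball.diff measurableSet_ball
    have hAi := (integrable_indicator_iff hAm).2 hA
    have hdiff := integrable_mu_iff.1 (hT1.sub hT2)
    rw [integral_mu, ← integral_indicator hAm, ← integral_prod_mul, ← integral_div]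
    refine integral_mono_ae ((hφi.mul_prod hAi).div_const _) hdiff ?_
    filter_upwards [Measure.quasiMeasurePreserving_fst.ae hu0,
      Measure.quasiMeasurePreserving_snd.ae hu0] with p hx hy
    obtain ⟨x, y⟩ := p
    simp only at hx hy ⊢
    have hpos := apply_sub_mul_testFn_nonneg (s := s) (R := R) (h := h) (u := u) hg (x, y)
    rw [← sub_mul]
    have hpos' := div_nonneg hpos (pow_nonneg (norm_nonneg (x - y)) n)
    by_cases hxΩ : x ∈ Metric.ball (0 : E n) (R / 3)
    · by_cases hyA : y ∈ Metric.ball (0 : E n) R \ Metric.ball 0 (R / 2)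
      · rw [indicator_of_mem hyA]
        exact annulus_gain hg hs0 hs1 hR hy hxΩ hyA
      · rw [indicator_of_notMem hyA, mul_zero, zero_div]
        exact hpos'
    · rw [testFn_eq_zero hR hx hxΩ, zero_mul, zero_div]
      exact hpos'
  rw [integral_sub hT1 hT2] at hgain
  linarith

end testing

/-! ### The weak Harnack inequality -/

lemma annulus_volume_ge {n : ℕ} (hn : 1 ≤ n) {R : ℝ} (hR : 0 < R) :
    R ^ n * volume.real (Metric.ball (0 : E n) 1) / 2 ≤
      volume.real (Metric.ball (0 : E n) R \ Metric.ball 0 (R / 2)) := by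
  have : Nonempty (Fin n) := ⟨⟨0, hn⟩⟩
  have hball : ∀ r : ℝ, 0 ≤ r → volume.real (Metric.ball (0 : E n) r) =
      r ^ n * volume.real (Metric.ball (0 : E n) 1) := by
    intro r hr
    rw [measureReal_def, Measure.addHaar_ball _ _ hr, ENNReal.toReal_mul,
      ENNReal.toReal_ofReal (by positivity), finrank_euclideanSpace_fin, measureReal_def]
  rw [measureReal_sdiff (Metric.ball_subset_ball (by linarith)) measurableSet_ball
      measure_ball_lt_top.ne, hball R hR.le, hball (R / 2) (by linarith)]
  have h1 : (R / 2) ^ n ≤ R ^ n / 2 := by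
    rw [div_pow]
    gcongr
    calc (2 : ℝ) = 2 ^ 1 := (pow_one 2).symm
      _ ≤ 2 ^ n := pow_le_pow_right₀ one_le_two hn
  have h2 : 0 ≤ volume.real (Metric.ball (0 : E n) 1) := measureReal_nonneg
  nlinarith

lemma aestronglyMeasurable_of_memLGloc {n : ℕ} {g : ℝ → ℝ} {u : E n → ℝ} (hu : MemLGloc g u) :
    AEStronglyMeasurable u := by
  have h := (aestronglyMeasurable_iUnion_iff (μ := volume) (f := u)
    (s := fun m : ℕ => Metric.closedBall (0 : E n) m)).2
      fun m => (hu _ (isCompact_closedBall 0 _)).1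
  rwa [Metric.iUnion_closedBall_nat, Measure.restrict_univ] at h

/-- For real-valued functions the essential infimum is a supremum of a set of reals, which has to
be bounded above for this to hold; it is, as the measure is nonzero. -/
lemma le_essInf_of_ae_le_real {α : Type*} [MeasurableSpace α] {ν : Measure α} (hν : ν ≠ 0)
    {f : α → ℝ} {c : ℝ} (h : ∀ᵐ x ∂ν, c ≤ f x) : c ≤ essInf f ν := by
  have hne : (ae ν).NeBot := ae_neBot.2 hν
  refine le_liminf_of_le ?_ h
  have hN : ∃ N : ℕ, ∃ᶠ x in ae ν, f x ≤ N := by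
    by_contra! hcon
    have h1 : ∀ᵐ x ∂ν, ∀ N : ℕ, (N : ℝ) < f x := by
      rw [ae_all_iff]
      intro N
      exact hcon N
    obtain ⟨x, hx⟩ := h1.exists
    obtain ⟨N, hN⟩ := exists_nat_ge (f x)
    exact absurd (hx N) (not_lt.2 hN)
  obtain ⟨N, hN⟩ := hN
  exact IsCoboundedUnder.of_frequently_le hN

/-- The constant in the lower bound for the gain from the annulus. -/
def annulusConst (n : ℕ) (D : ℝ) : ℝ :=
  volume.real (Metric.ball (0 : E n) 1) / (growthConst D 4 * 2 ^ (n + 2))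

lemma annulusConst_pos (n : ℕ) (D : ℝ) : 0 < annulusConst n D := by
  have h1 := growthConst_pos D 4
  have h2 : 0 < volume.real (Metric.ball (0 : E n) 1) :=
    ENNReal.toReal_pos (Metric.measure_ball_pos volume 0 one_pos).ne' measure_ball_lt_top.ne
  unfold annulusConst; positivity

/-- If the annulus average of `g (R^(-s) u)` exceeds what the barrier of height `h` and the
right-hand side allow, then `u` lies above that barrier. -/
theorem ae_ge_of_average_gt {n : ℕ} {s R h D : ℝ} {g : ℝ → ℝ} {u : E n → ℝ} (hn : 1 ≤ n)
    (hg : IsDoublingDensity D g) (hs0 : 0 < s) (hs1 : s < 1) (hR : 0 < R) (hh : 0 < h) {K : ℝ}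
    (hK : 0 ≤ K)
    (huW : MemWTilde g s (Metric.ball (0 : E n) (R / 3)) u)
    (hsup : IsWeakSupersolution g s (Metric.ball (0 : E n) (R / 3)) (fun _ => -K) u)
    (hu0 : ∀ᵐ x ∂(volume : Measure (E n)), 0 ≤ u x)
    (hA : IntegrableOn (fun x => g (R ^ (-s) * |u x|))
      (Metric.ball (0 : E n) R \ Metric.ball 0 (R / 2)))
    (hM : barrierConst n D s * g (h * R ^ (-s)) + R ^ s * K < annulusConst n D *
      ⨍ x in Metric.ball (0 : E n) R \ Metric.ball 0 (R / 2), g (R ^ (-s) * |u x|)) :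
    ∀ᵐ x ∂(volume.restrict (Metric.ball (0 : E n) (R / 4))), h ≤ u x := by
  have hu := aestronglyMeasurable_of_memLGloc huW.1
  have hφi := integrable_testFn hR hh.le hu hu0
  have hφ0 : 0 ≤ ∫ x, testFn R h u x := integral_nonneg fun x => testFn_nonneg x
  have hmain := integral_annulus_le hn hg hs0 hs1 hR hh hK huW hsup hu hu0 hA
  have hvol := annulus_volume_ge hn hR
  set A := Metric.ball (0 : E n) R \ Metric.ball 0 (R / 2) with hAdef
  set ω := volume.real (Metric.ball (0 : E n) 1) with hω
  have hω0 : 0 < ω :=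
    ENNReal.toReal_pos (Metric.measure_ball_pos volume 0 one_pos).ne' measure_ball_lt_top.ne
  set M := ⨍ x in A, g (R ^ (-s) * |u x|) with hMdef
  have hvpos : 0 < volume.real A := lt_of_lt_of_le (by positivity) hvol
  have hint : ∫ x in A, g (R ^ (-s) * |u x|) = volume.real A * M := by
    rw [hMdef, setAverage_eq, smul_eq_mul, mul_inv_cancel_left₀ hvpos.ne']
  have hC := growthConst_pos D 4
  have hM0 : 0 ≤ M := by
    rw [hMdef, setAverage_eq, smul_eq_mul]
    exact mul_nonneg (by positivity) (integral_nonneg fun x => hg.nonneg (by positivity))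
  have hzero : ∫ x, testFn R h u x = 0 := by
    by_contra hne
    have hpos : 0 < ∫ x, testFn R h u x := lt_of_le_of_ne hφ0 (Ne.symm hne)
    rw [hint] at hmain
    have h1 : (∫ x, testFn R h u x) * (annulusConst n D * M / R ^ s) ≤
        (∫ x, testFn R h u x) * (volume.real A * M) /
          (growthConst D 4 * 2 ^ (n + 1) * (R ^ s * R ^ n)) := by
      rw [mul_div_assoc (∫ x, testFn R h u x)]
      refine mul_le_mul_of_nonneg_left ?_ hφ0
      calc annulusConst n D * M / R ^ s = (R ^ n * ω / 2) * M /
            (growthConst D 4 * 2 ^ (n + 1) * (R ^ s * R ^ n)) := by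
            rw [annulusConst, ← hω]; field_simp; ring
        _ ≤ _ := by gcongr
    have h2 := h1.trans hmain
    rw [mul_comm] at h2
    have h3 := le_of_mul_le_mul_right h2 hpos
    have hRs : 0 < R ^ s := by positivity
    rw [div_le_iff₀ hRs, add_mul, div_mul_cancel₀ _ hRs.ne'] at h3
    linarith
  have hae := (integral_eq_zero_iff_of_nonneg (fun x => testFn_nonneg x) hφi).1 hzero
  filter_upwards [ae_restrict_of_ae hae, ae_restrict_mem measurableSet_ball] with x hx hxB
  have h1 : testFn R h u x = 0 := hx
  have h2 : scaledBarrier R h x - u x ≤ 0 := h1 ▸ le_max_left _ _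
  have h3 : h * 1 ≤ scaledBarrier R h x :=
    mul_le_mul_of_nonneg_left (one_le_barrier hR hxB) hh.le
  linarith

end FracOrlicz
end

theorem theorem3p2 (n : ℕ) (hn : 1 ≤ n) (s : ℝ) (hs0 : 0 < s) (hs1 : s < 1)
    (lam Lam : ℝ) (hlam : 1 < lam) :
    ∃ σ : ℝ, 0 < σ ∧ σ < 1 ∧ ∃ c₀ : ℝ, 0 < c₀ ∧
      ∀ g : ℝ → ℝ, FracOrlicz.IsAdmissible lam Lam g →
      ∀ R : ℝ, 0 < R → ∀ K : ℝ, 0 ≤ K →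
      ∀ u : FracOrlicz.E n → ℝ,
        FracOrlicz.MemWTilde g s (Metric.ball 0 (R / 3)) u →
        FracOrlicz.IsWeakSupersolution g s (Metric.ball 0 (R / 3)) (fun _ => -K) u →
        (∀ᵐ x ∂(volume : Measure (FracOrlicz.E n)), 0 ≤ u x) →
        essInf u (volume.restrict (Metric.ball (0 : FracOrlicz.E n) (R / 4))) ≥
          σ * R ^ s * FracOrlicz.ginv g
            (⨍ x in Metric.ball (0 : FracOrlicz.E n) R \ Metric.ball 0 (R / 2),
              g (R ^ (-s) * |u x|))
          - R ^ s * FracOrlicz.ginv g (c₀ * R ^ s * K) := by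
  set D := FracOrlicz.IsAdmissible.doublingConst Lam with hD
  set b := FracOrlicz.barrierConst n D s with hb
  set a := FracOrlicz.annulusConst n D with ha
  have hb0 : 0 ≤ b := FracOrlicz.barrierConst_nonneg n D s
  have ha0 : 0 < a := FracOrlicz.annulusConst_pos n D
  -- any `σ < 1` with `(b + 1) σ < a` works, with `c₀ = 1`
  refine ⟨min (1 / 2) (a / (2 * (b + 1))), by positivity,
    (min_le_left _ _).trans_lt (by norm_num), 1, one_pos, ?_⟩
  intro g hadm R hR K hK u huW hsup hu0
  have hg := hadm.isDoublingDensity hlam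
  set σ := min (1 / 2) (a / (2 * (b + 1))) with hσ
  have hσ0 : 0 < σ := by positivity
  have hσ1 : σ ≤ 1 := (min_le_left _ _).trans (by norm_num)
  have hσa : (b + 1) * σ ≤ a / 2 := by
    calc (b + 1) * σ ≤ (b + 1) * (a / (2 * (b + 1))) := by
          gcongr; exact min_le_right _ _
      _ = a / 2 := by field_simp
  set M := ⨍ x in Metric.ball (0 : FracOrlicz.E n) R \ Metric.ball 0 (R / 2),
              g (R ^ (-s) * |u x|) with hM
  have hM0 : 0 ≤ M := by
    rw [hM, setAverage_eq, smul_eq_mul]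
    exact mul_nonneg (by positivity) (integral_nonneg fun x => hg.nonneg (by positivity))
  have hRs : 0 < R ^ s := by positivity
  obtain ⟨hL0, hL⟩ := hg.ginv_spec hM0
  obtain ⟨hk0, hk⟩ := hg.ginv_spec (y := 1 * R ^ s * K) (by positivity)
  set L := FracOrlicz.ginv g M with hLdef
  set k := FracOrlicz.ginv g (1 * R ^ s * K) with hkdef
  refine FracOrlicz.le_essInf_of_ae_le_real ?_ ?_
  · rw [Ne, Measure.restrict_eq_zero]
    exact (Metric.measure_ball_pos volume 0 (by linarith)).ne'
  rcases le_or_gt (σ * R ^ s * L - R ^ s * k) 0 with hh | hh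
  · filter_upwards [ae_restrict_of_ae hu0] with x hx using hh.trans hx
  have hσL : k < σ * L := by
    have : 0 < R ^ s * (σ * L - k) := by linarith
    have := pos_of_mul_pos_right this hRs.le
    linarith
  have hLpos : 0 < L := by
    by_contra! hcon
    have : σ * L ≤ 0 := mul_nonpos_of_nonneg_of_nonpos hσ0.le hcon
    linarith
  have hMpos : 0 < M := hL ▸ hg.pos L hLpos
  -- a nonintegrable integrand has average zero
  have hA : IntegrableOn (fun x => g (R ^ (-s) * |u x|))
      (Metric.ball (0 : FracOrlicz.E n) R \ Metric.ball 0 (R / 2)) := by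
    by_contra hcon
    rw [hM, setAverage_eq, integral_undef hcon, smul_zero] at hMpos
    exact lt_irrefl _ hMpos
  refine FracOrlicz.ae_ge_of_average_gt hn hg hs0 hs1 hR hh hK huW hsup hu0 hA ?_
  have hgσ : g (σ * L) ≤ σ * M := by
    have := hg.apply_mul_le hσ0.le hσ1 hL0
    rwa [hL] at this
  have h1 : g ((σ * R ^ s * L - R ^ s * k) * R ^ (-s)) ≤ σ * M := by
    refine (hg.mono ?_).trans hgσ
    rw [Real.rpow_neg hR.le]
    have : (σ * R ^ s * L - R ^ s * k) * (R ^ s)⁻¹ = σ * L - k := by field_simp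
    rw [this]; linarith
  have h2 : R ^ s * K ≤ σ * M := by
    have := (hg.mono hσL.le).trans hgσ
    rw [hk] at this
    linarith
  have h3 := mul_le_mul_of_nonneg_left h1 hb0
  have h4 := mul_le_mul_of_nonneg_right hσa hM0
  have h5 := mul_pos ha0 hMpos
  linarith
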